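/- A permutation is an ordering of a finite set of positive integers, written in one-line notation, and $S_n$ is the set of permutations of $\{1,\ldots,n\}$. The normalization of a permutation of length $m$ is the element of $S_m$ obtained by replacing its $i$-th smallest entry by $i$ for all $i$; a permutation is normalized if it equals its normalization. A permutation $\sigma$ contains a pattern $\tau$ if some subsequence of $\sigma$ has normalization $\tau$, and it avoids $\tau$ otherwise. Let $\operatorname{Av}(\tau^{(1)},\ldots,\tau^{(r)})$ be the set of normalized permutations that avoid $\tau^{(1)},\ldots,\tau^{(r)}$, and let $\operatorname{Av}_n(\tau^{(1)},\ldots,\tau^{(r)})=\operatorname{Av}(\tau^{(1)},\ldots,\tau^{(r)})\cap S_n$. West's stack-sorting map $s$ sends the empty permutation to itself and sends $\pi=LmR$, where $m$ is the largest entry of $\pi$, to $s(\pi)=s(L)\,s(R)\,m$. For a set $A$ of permutations, $s^{-1}(A)$ is the set of permutations $\sigma$ with $s(\sigma)\in A$. **Theorem 3.1.** (a) As formal power series, $$\sum_{n\ge 0}\left|s^{-1}(\operatorname{Av}_n(231,321))\right|x^n=\frac{1}{1-xC(xC(x))},$$ where $C(x)=\dfrac{1-\sqrt{1-4x}}{2x}$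 is the generating function of the Catalan numbers. (b) $s^{-1}(\operatorname{Av}(231,321))=\operatorname{Av}(2341,3241,45231)$. (c) The classes $\operatorname{Av}(2341,3241,45231)$ and $\operatorname{Av}(4321,4213)$ are Wilf-equivalent, that is, $|\operatorname{Av}_n(2341,3241,45231)|=|\operatorname{Av}_n(4321,4213)|$ for all $n\ge 0$. This Wilf equivalence is unbalanced: for some $k$, the bases of the two classes contain different numbers of permutations of length $k$, where the basis of a class is the set of normalized permutations that do not belong to it and are minimal with this property under pattern containment. -/

import Mathlib

namespace StackSorting

/-- A permutation: an ordering of a finite set of positive integers, written in one-line notation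
as the list of its entries. -/
def IsPermutation (π : List ℕ) : Prop := π.Nodup ∧ ∀ a ∈ π, 0 < a

/-- `S n` is the set of permutations of `{1, …, n}`, i.e. of rearrangements of `[1, 2, …, n]`. -/
def S (n : ℕ) : Set (List ℕ) := {π | π.Perm (List.range' 1 n)}

/-- The normalization replaces the `i`-th smallest entry by `i`: an entry `a` is replaced
by the number of entries that are at most `a`. -/
def normalize (π : List ℕ) : List ℕ := π.map fun a => π.countP fun b => decide (b ≤ a)

/-- `σ` contains the pattern `τ`: some subsequence of `σ` has normalization `τ`. -/
def Contains (σ τ : List ℕ) : Prop := ∃ ρ : List ℕ, ρ.Sublist σ ∧ normalize ρ = τ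

/-- `Av T` is the set of normalized permutations that avoid all patterns in `T`. -/
def Av (T : Set (List ℕ)) : Set (List ℕ) :=
  {σ | IsPermutation σ ∧ normalize σ = σ ∧ ∀ τ ∈ T, ¬ Contains σ τ}

/-- The largest entry of a list of natural numbers (`0` for the empty list). -/
def largest (π : List ℕ) : ℕ := π.foldr max 0

theorem largest_mem (a : ℕ) (l : List ℕ) : largest (a :: l) ∈ a :: l := by
  induction l generalizing a with
  | nil => simp [largest]
  | cons b l ih =>
    have h : largest (a :: b :: l) = max a (largest (b :: l)) := rfl
    rcases max_choice a (largest (b :: l)) with h' | h'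
    · rw [h, h']; exact List.mem_cons_self
    · rw [h, h']; exact List.mem_cons_of_mem _ (ih b)

/-- The entries to the left of the largest entry. -/
def leftPart (π : List ℕ) : List ℕ := π.take (π.idxOf (largest π))

/-- The entries to the right of the largest entry. -/
def rightPart (π : List ℕ) : List ℕ := π.drop (π.idxOf (largest π) + 1)

/-- West's stack-sorting map: the empty permutation is sent to itself, and `π = L m R`,
with `m` the largest entry, is sent to `s(L) s(R) m`. -/
def stackSort : List ℕ → List ℕ
  | [] => []
  | a :: l =>
    stackSort (leftPart (a :: l)) ++ stackSort (rightPart (a :: l)) ++ [largest (a :: l)]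
termination_by π => π.length
decreasing_by
  · have h := List.idxOf_lt_length_of_mem (largest_mem a l)
    simp only [leftPart, List.length_take]
    omega
  · simp only [rightPart, List.length_drop, List.length_cons]
    omega

/-- `s⁻¹(A)`: the set of permutations whose image under the stack-sorting map lies in `A`. -/
def stackPreimage (A : Set (List ℕ)) : Set (List ℕ) := {σ | IsPermutation σ ∧ stackSort σ ∈ A}

/-- Two sets of normalized permutations are Wilf-equivalent if they have, for every `n`,
equally many elements of length `n`. -/
def WilfEquivalent (A B : Set (List ℕ)) : Prop :=
  ∀ n : ℕ, (A ∩ S n).ncard = (B ∩ S n).ncard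

/-- The basis of a permutation class `A`: the normalized permutations that are not in `A` and are
minimal with this property with respect to pattern containment. -/
def basis (A : Set (List ℕ)) : Set (List ℕ) :=
  {τ | IsPermutation τ ∧ normalize τ = τ ∧ τ ∉ A ∧ ∀ ρ, Contains τ ρ → ρ ≠ τ → ρ ∈ A}

/-- A Wilf equivalence between two permutation classes is unbalanced if their bases do not contain
the same number of permutations of each length. -/
def UnbalancedWilfEquivalent (A B : Set (List ℕ)) : Prop :=
  WilfEquivalent A B ∧ ∃ k : ℕ, (basis A ∩ S k).ncard ≠ (basis B ∩ S k).ncard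

/-- `C(x) = (1 - √(1 - 4x)) / (2x)`, the generating function of the Catalan numbers. -/
noncomputable def catalanGF : PowerSeries ℚ := PowerSeries.mk fun n => (catalan n : ℚ)

end StackSorting

namespace StackSorting

/-! Stack-sorting keeps an entry `b` ahead of a smaller `a` exactly when something larger than `b`
stands between them (`pair_sublist_stackSort`). A word contains 231 or 321 exactly when some entry
has two larger entries ahead of it. Pulling such a configuration back through the two separating
entries gives 2341, 3241 or 45231, which is (b) (`stackSort_avoids_iff`).

For the enumeration, each of these patterns ends in its minimum; deleting it leaves 123, 213, 3412.
Reverse complement turns Av(4321, 4213) into Av(4321, 2431), where deleting the final minimum leaves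
321, 132. Grow permutations by inserting a new minimum: a site is allowed exactly when the prefix
before it is free of the shortened patterns. So the allowed sites depend only on the longest free
prefix, and this prefix also determines its successor (`IsMaxPrefix.insertMin`). For the first class
the prefix is a decreasing list with one entry moved left; for the second it is an increasing list
with two adjacent blocks interchanged. In both cases two parameters `(s, q)` suffice, there are `q +
s + 1` sites, and the multisets of child labels agree. Hence both classes are counted by `treeCount
n 0 0` (`card_permClass`).

The generating function of the subtree below `(s, q)` factors as `C ^ (s + 1) * H q`, where `H`
solves a linear recurrence of order two with characteristic root `C(x) * C(xC(x))`; this gives (a).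
The equivalence is unbalanced because 45231 is a basis element of length 5, whereas the other basis
lies in {4321, 4213}. -/

/-- The number of nodes at depth `n` below a node with label `(s, q)` in the generating tree
in which `(s, q)` has the children `(q - i, i + 1)` for `i ≤ q` and `(j + 2, q)` for `j < s`. -/
def treeCount : ℕ → ℕ → ℕ → ℕ
  | 0, _, _ => 1
  | n + 1, s, q => ∑ i ∈ Finset.range (q + 1), treeCount n (q - i) (i + 1) +
      ∑ j ∈ Finset.range s, treeCount n (j + 2) q

/-! ### Generating function of the tree -/

section GeneratingFunction

open PowerSeries

/-- A family of power series that satisfies the equations of the generating tree counts its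
nodes by depth. -/
theorem coeff_eq_treeCount (Φ : ℕ → ℕ → PowerSeries ℚ)
    (hΦ : ∀ s q, Φ s q = 1 + X * (∑ i ∈ Finset.range (q + 1), Φ (q - i) (i + 1) +
      ∑ j ∈ Finset.range s, Φ (j + 2) q)) (n s q : ℕ) :
    coeff n (Φ s q) = treeCount n s q := by
  induction n generalizing s q with
  | zero =>
    rw [hΦ]
    simp [treeCount]
  | succ n ih =>
    rw [hΦ, map_add, coeff_succ_X_mul]
    simp [treeCount, ih, coeff_one]

theorem catalanGF_eq : catalanGF = 1 + X * catalanGF ^ 2 := by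
  have h : catalanGF = (catalanSeries).map (Nat.castRingHom ℚ) := by
    ext n
    simp [catalanGF]
  have h' := congrArg (PowerSeries.map (Nat.castRingHom ℚ)) catalanSeries_sq_mul_X_add_one
  rw [map_add, map_mul, map_pow, map_one, map_X, ← h] at h'
  rw [mul_comm, add_comm, h']

theorem constantCoeff_catalanGF : constantCoeff catalanGF = 1 := by
  rw [catalanGF_eq]; simp

theorem hasSubst_X_mul_catalanGF : HasSubst (X * catalanGF) :=
  HasSubst.of_constantCoeff_zero' (by simp)

/-- The series `C(xC(x))`. -/
noncomputable def catalanComp : PowerSeries ℚ := subst (X * catalanGF) catalanGF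

theorem catalanComp_eq : catalanComp = 1 + X * catalanGF * catalanComp ^ 2 := by
  have hs := hasSubst_X_mul_catalanGF
  have h := congrArg (substAlgHom (R := ℚ) hs) catalanGF_eq
  rw [map_add, map_mul, map_pow, map_one, coe_substAlgHom, subst_X hs] at h
  exact h

theorem constantCoeff_catalanComp : constantCoeff catalanComp = 1 := by
  rw [catalanComp_eq]; simp

/-- The tree equations determine their solution, so it is enough to exhibit one. The ansatz `C ^ (s
+ 1) * H q` absorbs the sum over `j < s` by a geometric series and leaves the single family of
equations `hstar` for `H`. -/
theorem coeff_eq_treeCount_root (n : ℕ) :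
    coeff n (1 - X * catalanComp)⁻¹ = (treeCount n 0 0 : ℚ) := by
  set C := catalanGF with hCdef
  set B := catalanComp with hBdef
  have hC : C = 1 + X * C ^ 2 := catalanGF_eq
  have hB : B = 1 + X * C * B ^ 2 := catalanComp_eq
  have hC0 : constantCoeff C = 1 := constantCoeff_catalanGF
  have hB0 : constantCoeff B = 1 := constantCoeff_catalanComp
  -- `G` equals `C - X * C ^ 2 * B`, the factor that multiplies the free constant of the recurrence
  -- in the equation for `q = 0`.
  set G := C - C * B + B with hG
  have hG0 : constantCoeff G = 1 := by simp [hG, hC0, hB0]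
  -- The constant coefficient of `(1 + C ^ 2) * G` is 2, which is invertible in `ℚ`.
  set D := ((1 + C ^ 2) * G)⁻¹ with hDdef
  have hD : (1 + C ^ 2) * G * D = 1 :=
    PowerSeries.mul_inv_cancel _ (by simp [hG0, hC0])
  have hCB : C * B = C + (C - 1) * B ^ 2 := by linear_combination C * hB - B ^ 2 * hC
  -- The summand `C * D * G = C / (1 + C ^ 2)` is the constant solution of the recurrence `h2`
  -- below. The factor `C * B` is the root of `X * t ^ 2 - t + C = 0` that is a power series, and
  -- its coefficient `C * D` is forced by the case `q = 0`.
  set H : ℕ → PowerSeries ℚ := fun q => C * D * (G + (C * B) ^ q) with hH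
  have hGG : G ^ 2 - C * G + C ^ 2 - C = 0 := by
    rw [hG]; linear_combination (1 - C) * hCB
  have hroot : C * H 0 * (1 - X * B) = 1 := by
    have hCne : (C : PowerSeries ℚ) ≠ 0 := by
      intro h; simp [h] at hC0
    have h1 : C ^ 2 * (1 - X * B) = G + C ^ 2 - C := by
      rw [hG]; linear_combination B * hC
    simp only [hH, pow_zero]
    linear_combination D * (G + 1) * h1 + hD + D * hGG
  have hstar : ∀ q, C * H q = 1 + X * ∑ i ∈ Finset.range (q + 1), C ^ (q - i + 1) * H (i + 1) := by
    intro q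
    induction q with
    | zero =>
      simp only [zero_add, Finset.range_one, Finset.sum_singleton, Nat.sub_self, pow_one]
      simp only [hH, pow_zero, pow_one]
      linear_combination hD + D * (G + C * B) * hC - C * D * hG
    | succ q ih =>
      have h1 : ∑ i ∈ Finset.range (q + 1), C ^ (q + 1 - i + 1) * H (i + 1) =
          C * ∑ i ∈ Finset.range (q + 1), C ^ (q - i + 1) * H (i + 1) := by
        rw [Finset.mul_sum]
        refine Finset.sum_congr rfl fun i hi => ?_
        have : q + 1 - i = q - i + 1 := by have := Finset.mem_range.1 hi; omega
        rw [this]; ring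
      rw [Finset.sum_range_succ, h1, Nat.sub_self]
      -- Subtracting `C` times the equation for `q` from the one for `q + 1` cancels all of the sum
      -- except its last term.
      have h2 : C * H (q + 1) = 1 + C * (C * H q - 1) + X * C * H (q + 2) := by
        simp only [hH, pow_succ]
        linear_combination C ^ 2 * D * (C * B) ^ q * hCB - (C - 1) * hD +
          D * (G + (C * B) ^ q * C ^ 2 * B ^ 2) * hC
      linear_combination h2 + C * ih
  -- The sum telescopes because `X * C ^ 2 = C - 1`.
  have hgeom : ∀ s, X * ∑ j ∈ Finset.range s, C ^ (j + 3) = C ^ (s + 1) - C := by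
    intro s
    induction s with
    | zero => simp
    | succ s ih =>
      rw [Finset.sum_range_succ, mul_add, ih]
      linear_combination (-C ^ (s + 1)) * hC
  have hΦ := coeff_eq_treeCount (fun s q => C ^ (s + 1) * H q) (fun s q => by
    have h1 : ∑ j ∈ Finset.range s, C ^ (j + 2 + 1) * H q =
        (∑ j ∈ Finset.range s, C ^ (j + 3)) * H q := by rw [Finset.sum_mul]
    rw [h1]
    linear_combination hstar q - H q * hgeom s) n 0 0
  rw [← hΦ, zero_add, pow_one]
  congr 1
  exact (PowerSeries.inv_eq_iff_mul_eq_one (by simp)).2 hroot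

end GeneratingFunction

/-! ### Sublists of lists without repetition -/

section Lists

variable {α : Type*}

theorem pair_sublist_append {x y : α} {l₁ l₂ : List α} :
    [x, y].Sublist (l₁ ++ l₂) ↔
      [x, y].Sublist l₁ ∨ (x ∈ l₁ ∧ y ∈ l₂) ∨ [x, y].Sublist l₂ := by
  induction l₁ with
  | nil => simp
  | cons a l₁ ih =>
    rw [List.cons_append, List.sublist_cons_iff, ih, List.sublist_cons_iff (l' := l₁)]
    constructor
    · rintro ((h | h | h) | ⟨r, h1, h2⟩)
      · exact Or.inl (Or.inl h)
      · exact Or.inr (Or.inl ⟨List.mem_cons_of_mem _ h.1, h.2⟩)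
      · exact Or.inr (Or.inr h)
      · simp only [List.cons.injEq] at h1
        obtain ⟨rfl, rfl⟩ := h1
        rw [List.singleton_sublist, List.mem_append] at h2
        rcases h2 with h2 | h2
        · exact Or.inl (Or.inr ⟨_, rfl, List.singleton_sublist.2 h2⟩)
        · exact Or.inr (Or.inl ⟨List.mem_cons_self, h2⟩)
    · rintro ((h | ⟨r, h1, h2⟩) | ⟨h1, h2⟩ | h)
      · exact Or.inl (Or.inl h)
      · simp only [List.cons.injEq] at h1
        obtain ⟨rfl, rfl⟩ := h1
        rw [List.singleton_sublist] at h2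
        exact Or.inr ⟨_, rfl, List.singleton_sublist.2 (List.mem_append_left _ h2)⟩
      · rcases List.mem_cons.1 h1 with rfl | h1
        · exact Or.inr ⟨_, rfl, List.singleton_sublist.2 (List.mem_append_right _ h2)⟩
        · exact Or.inl (Or.inr (Or.inl ⟨h1, h2⟩))
      · exact Or.inl (Or.inr (Or.inr h))

/-- Without repetitions the entry `y` has only one position, so the two sublists can be glued there.
-/
theorem sublist_cons_of_pair {x y : α} {t l : List α} (hl : l.Nodup)
    (hxy : [x, y].Sublist l) (hyt : (y :: t).Sublist l) : (x :: y :: t).Sublist l := by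
  induction l with
  | nil => simp at hxy
  | cons a l ih =>
    rw [List.nodup_cons] at hl
    rw [List.sublist_cons_iff] at hxy ⊢
    rcases hxy with hxy | ⟨r, hr, hr'⟩
    · have hya : y ≠ a := by
        rintro rfl
        exact hl.1 (hxy.subset (by simp))
      rcases List.sublist_cons_iff.1 hyt with h | ⟨r, hr, _⟩
      · exact Or.inl (ih hl.2 hxy h)
      · simp only [List.cons.injEq] at hr
        exact absurd hr.1 hya
    · simp only [List.cons.injEq] at hr
      obtain ⟨rfl, rfl⟩ := hr
      rw [List.singleton_sublist] at hr'
      rcases List.sublist_cons_iff.1 hyt with h | ⟨r, hr, _⟩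
      · exact Or.inr ⟨_, rfl, h⟩
      · simp only [List.cons.injEq] at hr
        exact absurd (hr.1 ▸ hr') hl.1

theorem pair_sublist_or {x y : α} {l : List α} (hx : x ∈ l) (hy : y ∈ l) (hxy : x ≠ y) :
    [x, y].Sublist l ∨ [y, x].Sublist l := by
  obtain ⟨s, t, rfl⟩ := List.append_of_mem hx
  rw [List.mem_append, List.mem_cons] at hy
  rcases hy with hy | rfl | hy
  · exact Or.inr (pair_sublist_append.2 (Or.inr (Or.inl ⟨hy, by simp⟩)))
  · exact absurd rfl hxy
  · exact Or.inl (pair_sublist_append.2 (Or.inr (Or.inr (by simpa using hy))))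

theorem triple_sublist_or {x y z : α} {l : List α} (hl : l.Nodup) (hx : [x, z].Sublist l)
    (hy : [y, z].Sublist l) (hxy : x ≠ y) :
    [x, y, z].Sublist l ∨ [y, x, z].Sublist l := by
  rcases pair_sublist_or (hx.subset (by simp)) (hy.subset (by simp)) hxy with h | h
  · exact Or.inl (sublist_cons_of_pair hl h hy)
  · exact Or.inr (sublist_cons_of_pair hl h hx)

end Lists

/-! ### Normalization and patterns as inequalities -/

section Normalization

/-- Normalized values are ranks; this recovers the order of the entries from the order of their
ranks. -/
theorem countP_le_lt_countP_le_iff {ρ : List ℕ} {a b : ℕ} (hb : b ∈ ρ) :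
    ρ.countP (fun c => decide (c ≤ a)) < ρ.countP (fun c => decide (c ≤ b)) ↔ a < b := by
  constructor
  · intro h
    by_contra hab
    refine absurd h (not_lt.2 (List.countP_mono_left fun c _ hc => ?_))
    simp only [decide_eq_true_eq] at hc ⊢
    omega
  · intro hab
    obtain ⟨s, t, rfl⟩ := List.append_of_mem hb
    have hs : ∀ r : List ℕ, r.countP (fun c => decide (c ≤ a)) ≤
        r.countP (fun c => decide (c ≤ b)) := fun r =>
      List.countP_mono_left fun c _ hc => by
        simp only [decide_eq_true_eq] at hc ⊢
        omega
    have h1 := hs s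
    have h2 := hs t
    rw [List.countP_append, List.countP_append, List.countP_cons_of_neg (by simpa using hab),
      List.countP_cons_of_pos (by simp)]
    omega

/-- Lists whose entries compare in the same way have the same normalization. -/
theorem normalize_map_eq {τ : List ℕ} {f : ℕ → ℕ} (hf : ∀ a ∈ τ, ∀ b ∈ τ, f a ≤ f b ↔ a ≤ b) :
    normalize (τ.map f) = normalize τ := by
  unfold normalize
  rw [List.map_map]
  refine List.map_congr_left fun a ha => ?_
  simp only [Function.comp_apply, List.countP_map]
  refine List.countP_congr fun b hb => ?_
  simp [hf b hb a ha]

theorem normalize_length (π : List ℕ) : (normalize π).length = π.length := by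
  simp [normalize]

theorem contains_231_iff {σ : List ℕ} :
    Contains σ [2, 3, 1] ↔ ∃ a b c, [a, b, c].Sublist σ ∧ c < a ∧ a < b := by
  constructor
  · rintro ⟨ρ, hρ, h⟩
    have hl := congrArg List.length h
    rw [normalize_length] at hl
    match ρ, hl with
    | [a, b, c], _ =>
      refine ⟨a, b, c, hρ, ?_⟩
      simp only [normalize, List.map_cons, List.map_nil, List.cons.injEq, and_true] at h
      rw [← countP_le_lt_countP_le_iff (ρ := [a, b, c]) (by simp : a ∈ _),
        ← countP_le_lt_countP_le_iff (ρ := [a, b, c]) (by simp : b ∈ _)]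
      omega
  · rintro ⟨a, b, c, hρ, h⟩
    refine ⟨_, hρ, ?_⟩
    -- The lookup table sends each pattern value to the entry of that rank. Its leading 0 is a
    -- dummy, as pattern values start at 1.
    have : [a, b, c] = [2, 3, 1].map ([0, c, a, b].getD · 0) := rfl
    rw [this, normalize_map_eq]
    · decide
    · simp
      omega

theorem contains_321_iff {σ : List ℕ} :
    Contains σ [3, 2, 1] ↔ ∃ a b c, [a, b, c].Sublist σ ∧ c < b ∧ b < a := by
  constructor
  · rintro ⟨ρ, hρ, h⟩
    have hl := congrArg List.length h
    rw [normalize_length] at hl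
    match ρ, hl with
    | [a, b, c], _ =>
      refine ⟨a, b, c, hρ, ?_⟩
      simp only [normalize, List.map_cons, List.map_nil, List.cons.injEq, and_true] at h
      rw [← countP_le_lt_countP_le_iff (ρ := [a, b, c]) (by simp : b ∈ _),
        ← countP_le_lt_countP_le_iff (ρ := [a, b, c]) (by simp : a ∈ _)]
      omega
  · rintro ⟨a, b, c, hρ, h⟩
    refine ⟨_, hρ, ?_⟩
    have : [a, b, c] = [3, 2, 1].map ([0, c, b, a].getD · 0) := rfl
    rw [this, normalize_map_eq]
    · decide
    · simp
      omega

theorem contains_2341_iff {σ : List ℕ} :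
    Contains σ [2, 3, 4, 1] ↔ ∃ a b c d, [a, b, c, d].Sublist σ ∧ d < a ∧ a < b ∧ b < c := by
  constructor
  · rintro ⟨ρ, hρ, h⟩
    have hl := congrArg List.length h
    rw [normalize_length] at hl
    match ρ, hl with
    | [a, b, c, d], _ =>
      refine ⟨a, b, c, d, hρ, ?_⟩
      simp only [normalize, List.map_cons, List.map_nil, List.cons.injEq, and_true] at h
      rw [← countP_le_lt_countP_le_iff (ρ := [a, b, c, d]) (by simp : a ∈ _),
        ← countP_le_lt_countP_le_iff (ρ := [a, b, c, d]) (by simp : b ∈ _),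
        ← countP_le_lt_countP_le_iff (ρ := [a, b, c, d]) (by simp : c ∈ _)]
      omega
  · rintro ⟨a, b, c, d, hρ, h⟩
    refine ⟨_, hρ, ?_⟩
    have : [a, b, c, d] = [2, 3, 4, 1].map ([0, d, a, b, c].getD · 0) := rfl
    rw [this, normalize_map_eq]
    · decide
    · simp
      omega

theorem contains_3241_iff {σ : List ℕ} :
    Contains σ [3, 2, 4, 1] ↔ ∃ a b c d, [a, b, c, d].Sublist σ ∧ d < b ∧ b < a ∧ a < c := by
  constructor
  · rintro ⟨ρ, hρ, h⟩
    have hl := congrArg List.length h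
    rw [normalize_length] at hl
    match ρ, hl with
    | [a, b, c, d], _ =>
      refine ⟨a, b, c, d, hρ, ?_⟩
      simp only [normalize, List.map_cons, List.map_nil, List.cons.injEq, and_true] at h
      rw [← countP_le_lt_countP_le_iff (ρ := [a, b, c, d]) (by simp : b ∈ _),
        ← countP_le_lt_countP_le_iff (ρ := [a, b, c, d]) (by simp : a ∈ _),
        ← countP_le_lt_countP_le_iff (ρ := [a, b, c, d]) (by simp : c ∈ _)]
      omega
  · rintro ⟨a, b, c, d, hρ, h⟩
    refine ⟨_, hρ, ?_⟩
    have : [a, b, c, d] = [3, 2, 4, 1].map ([0, d, b, a, c].getD · 0) := rfl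
    rw [this, normalize_map_eq]
    · decide
    · simp
      omega

theorem contains_4321_iff {σ : List ℕ} :
    Contains σ [4, 3, 2, 1] ↔ ∃ a b c d, [a, b, c, d].Sublist σ ∧ d < c ∧ c < b ∧ b < a := by
  constructor
  · rintro ⟨ρ, hρ, h⟩
    have hl := congrArg List.length h
    rw [normalize_length] at hl
    match ρ, hl with
    | [a, b, c, d], _ =>
      refine ⟨a, b, c, d, hρ, ?_⟩
      simp only [normalize, List.map_cons, List.map_nil, List.cons.injEq, and_true] at h
      rw [← countP_le_lt_countP_le_iff (ρ := [a, b, c, d]) (by simp : c ∈ _),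
        ← countP_le_lt_countP_le_iff (ρ := [a, b, c, d]) (by simp : b ∈ _),
        ← countP_le_lt_countP_le_iff (ρ := [a, b, c, d]) (by simp : a ∈ _)]
      omega
  · rintro ⟨a, b, c, d, hρ, h⟩
    refine ⟨_, hρ, ?_⟩
    have : [a, b, c, d] = [4, 3, 2, 1].map ([0, d, c, b, a].getD · 0) := rfl
    rw [this, normalize_map_eq]
    · decide
    · simp
      omega

theorem contains_4213_iff {σ : List ℕ} :
    Contains σ [4, 2, 1, 3] ↔ ∃ a b c d, [a, b, c, d].Sublist σ ∧ c < b ∧ b < d ∧ d < a := by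
  constructor
  · rintro ⟨ρ, hρ, h⟩
    have hl := congrArg List.length h
    rw [normalize_length] at hl
    match ρ, hl with
    | [a, b, c, d], _ =>
      refine ⟨a, b, c, d, hρ, ?_⟩
      simp only [normalize, List.map_cons, List.map_nil, List.cons.injEq, and_true] at h
      rw [← countP_le_lt_countP_le_iff (ρ := [a, b, c, d]) (by simp : b ∈ _),
        ← countP_le_lt_countP_le_iff (ρ := [a, b, c, d]) (by simp : d ∈ _),
        ← countP_le_lt_countP_le_iff (ρ := [a, b, c, d]) (by simp : a ∈ _)]
      omega
  · rintro ⟨a, b, c, d, hρ, h⟩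
    refine ⟨_, hρ, ?_⟩
    have : [a, b, c, d] = [4, 2, 1, 3].map ([0, c, b, d, a].getD · 0) := rfl
    rw [this, normalize_map_eq]
    · decide
    · simp
      omega

theorem contains_45231_iff {σ : List ℕ} :
    Contains σ [4, 5, 2, 3, 1] ↔ ∃ a b c d e, [a, b, c, d, e].Sublist σ ∧ e < c ∧ c < d ∧ d < a ∧ a < b := by
  constructor
  · rintro ⟨ρ, hρ, h⟩
    have hl := congrArg List.length h
    rw [normalize_length] at hl
    match ρ, hl with
    | [a, b, c, d, e], _ =>
      refine ⟨a, b, c, d, e, hρ, ?_⟩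
      simp only [normalize, List.map_cons, List.map_nil, List.cons.injEq, and_true] at h
      rw [← countP_le_lt_countP_le_iff (ρ := [a, b, c, d, e]) (by simp : c ∈ _),
        ← countP_le_lt_countP_le_iff (ρ := [a, b, c, d, e]) (by simp : d ∈ _),
        ← countP_le_lt_countP_le_iff (ρ := [a, b, c, d, e]) (by simp : a ∈ _),
        ← countP_le_lt_countP_le_iff (ρ := [a, b, c, d, e]) (by simp : b ∈ _)]
      omega
  · rintro ⟨a, b, c, d, e, hρ, h⟩
    refine ⟨_, hρ, ?_⟩
    have : [a, b, c, d, e] = [4, 5, 2, 3, 1].map ([0, e, c, d, a, b].getD · 0) := rfl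
    rw [this, normalize_map_eq]
    · decide
    · simp
      omega

theorem length_of_mem_S {n : ℕ} {σ : List ℕ} (h : σ ∈ S n) : σ.length = n := by
  simpa using List.Perm.length_eq h

theorem nodup_of_mem_S {n : ℕ} {σ : List ℕ} (h : σ ∈ S n) : σ.Nodup :=
  (List.Perm.nodup_iff h).2 List.nodup_range'

theorem mem_iff_of_mem_S {n : ℕ} {σ : List ℕ} (h : σ ∈ S n) {a : ℕ} :
    a ∈ σ ↔ 1 ≤ a ∧ a ≤ n := by
  rw [List.Perm.mem_iff h, List.mem_range'_1]
  omega

theorem countP_le_range' (n a : ℕ) :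
    (List.range' 1 n).countP (fun b => decide (b ≤ a)) = min n a := by
  induction n with
  | zero => simp
  | succ n ih =>
    rw [List.range'_1_concat, List.countP_append, ih]
    by_cases h : 1 + n ≤ a
    · rw [List.countP_cons_of_pos (by simpa using h)]
      simp only [List.countP_nil]; omega
    · rw [List.countP_cons_of_neg (by simpa using h)]
      simp only [List.countP_nil]; omega

theorem isPermutation_of_mem_S {n : ℕ} {σ : List ℕ} (h : σ ∈ S n) : IsPermutation σ :=
  ⟨nodup_of_mem_S h, fun _ ha => ((mem_iff_of_mem_S h).1 ha).1⟩

theorem normalize_of_mem_S {n : ℕ} {σ : List ℕ} (h : σ ∈ S n) : normalize σ = σ := by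
  unfold normalize
  conv_rhs => rw [← List.map_id σ]
  refine List.map_congr_left fun a ha => ?_
  rw [List.Perm.countP_eq _ h, countP_le_range']
  exact min_eq_right ((mem_iff_of_mem_S h).1 ha).2

/-- The normalized permutations of length `n` are the rearrangements of `1, …, n`. -/
theorem mem_S_length {σ : List ℕ} (h : IsPermutation σ) (hn : normalize σ = σ) :
    σ ∈ S σ.length := by
  have hsub : σ ⊆ List.range' 1 σ.length := by
    intro a ha
    rw [List.mem_range'_1]
    refine ⟨h.2 a ha, ?_⟩
    rw [← hn] at ha
    obtain ⟨b, -, rfl⟩ := List.mem_map.1 ha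
    have := List.countP_le_length (p := fun c => decide (c ≤ b)) (l := σ)
    omega
  exact (List.subperm_of_subset h.1 hsub).perm_of_length_le (by simp)

theorem mem_Av_iff {T : Set (List ℕ)} {σ : List ℕ} :
    σ ∈ Av T ↔ σ ∈ S σ.length ∧ ∀ τ ∈ T, ¬ Contains σ τ :=
  ⟨fun h => ⟨mem_S_length h.1 h.2.1, h.2.2⟩,
    fun h => ⟨isPermutation_of_mem_S h.1, normalize_of_mem_S h.1, h.2⟩⟩

theorem mem_Av_inter_S_iff {T : Set (List ℕ)} {n : ℕ} {σ : List ℕ} :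
    σ ∈ Av T ∩ S n ↔ σ ∈ S n ∧ ∀ τ ∈ T, ¬ Contains σ τ := by
  rw [Set.mem_inter_iff, mem_Av_iff]
  constructor
  · exact fun h => ⟨h.2, h.1.2⟩
  · intro h
    have := length_of_mem_S h.1
    exact ⟨⟨this ▸ h.1, h.2⟩, h.1⟩

end Normalization

/-! ### The stack-sorting map and its preimage -/

theorem le_largest {π : List ℕ} {a : ℕ} (h : a ∈ π) : a ≤ largest π := by
  induction π with
  | nil => simp at h
  | cons b π ih =>
    have hb : largest (b :: π) = max b (largest π) := rfl
    rw [hb]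
    rcases List.mem_cons.1 h with rfl | h
    · exact le_max_left _ _
    · exact (ih h).trans (le_max_right _ _)

theorem largest_append_cons {L R : List ℕ} {m : ℕ} (hL : ∀ a ∈ L, a < m) (hR : ∀ a ∈ R, a < m) :
    largest (L ++ m :: R) = m := by
  refine le_antisymm ?_ (le_largest (by simp))
  have h : largest (L ++ m :: R) ∈ L ++ m :: R := by
    cases L with
    | nil => exact largest_mem _ _
    | cons a L => exact largest_mem _ _
  rw [List.mem_append, List.mem_cons] at h
  rcases h with h | h | h
  · exact (hL _ h).le
  · exact h.le
  · exact (hR _ h).le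

theorem stackSort_append_cons {L R : List ℕ} {m : ℕ} (hL : ∀ a ∈ L, a < m)
    (hR : ∀ a ∈ R, a < m) :
    stackSort (L ++ m :: R) = stackSort L ++ stackSort R ++ [m] := by
  have hm : m ∉ L := fun h => lt_irrefl _ (hL m h)
  have hlarge := largest_append_cons hL hR
  have hidx : (L ++ m :: R).idxOf m = L.length := by
    rw [List.idxOf_append_of_notMem hm]; simp
  have hl : leftPart (L ++ m :: R) = L := by
    rw [leftPart, hlarge, hidx]; simp
  have hr : rightPart (L ++ m :: R) = R := by
    rw [rightPart, hlarge, hidx, List.drop_append]; simp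
  have key : ∀ π : List ℕ, π ≠ [] →
      stackSort π = stackSort (leftPart π) ++ stackSort (rightPart π) ++ [largest π] := by
    intro π hπ
    cases π with
    | nil => exact absurd rfl hπ
    | cons a l => rw [stackSort]
  rw [key _ (by simp), hl, hr, hlarge]

theorem exists_append_largest {π : List ℕ} (hπ : π.Nodup) (h : π ≠ []) :
    ∃ L m R, π = L ++ m :: R ∧ (∀ a ∈ L, a < m) ∧ ∀ a ∈ R, a < m := by
  have hmem : largest π ∈ π := by
    cases π with
    | nil => exact absurd rfl h
    | cons a l => exact largest_mem _ _
  obtain ⟨L, R, hLR⟩ := List.append_of_mem hmem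
  refine ⟨L, largest π, R, hLR, fun a ha => ?_, fun a ha => ?_⟩
  · refine lt_of_le_of_ne (le_largest (hLR ▸ List.mem_append_left _ ha)) ?_
    rintro hm
    rw [hLR] at hπ
    exact (List.nodup_append.1 hπ).2.2 a ha _ (List.mem_cons_self) hm
  · refine lt_of_le_of_ne
      (le_largest (hLR ▸ List.mem_append_right _ (List.mem_cons_of_mem _ ha))) ?_
    rintro hm
    rw [hLR] at hπ
    exact (List.nodup_cons.1 (List.nodup_append.1 hπ).2.1).1 (hm ▸ ha)

/-- Induction along the decomposition `π = L m R` that defines the stack-sorting map. -/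
theorem nodup_induction {P : List ℕ → Prop} (nil : P [])
    (append_cons : ∀ L m R, (L ++ m :: R).Nodup → (∀ a ∈ L, a < m) → (∀ a ∈ R, a < m) →
      P L → P R → P (L ++ m :: R)) : ∀ π : List ℕ, π.Nodup → P π := by
  intro π
  induction hn : π.length using Nat.strong_induction_on generalizing π with
  | _ n ih =>
    intro hπ
    rcases eq_or_ne π [] with rfl | hne
    · exact nil
    · obtain ⟨L, m, R, rfl, hL, hR⟩ := exists_append_largest hπ hne
      simp only [List.length_append, List.length_cons] at hn
      have h := List.nodup_append.1 hπ
      exact append_cons L m R hπ hL hR (ih L.length (by omega) L rfl h.1)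
        (ih R.length (by omega) R rfl (List.nodup_cons.1 h.2.1).2)

theorem stackSort_perm {π : List ℕ} (hπ : π.Nodup) : (stackSort π).Perm π := by
  refine nodup_induction (P := fun π => (stackSort π).Perm π) (by simp [stackSort]) ?_ π hπ
  intro L m R _ hL hR ihL ihR
  rw [stackSort_append_cons hL hR, List.append_assoc]
  refine ihL.append ((List.perm_append_comm).trans ?_)
  exact List.Perm.cons m ihR

/-- An entry `b` stays ahead of a smaller entry `a` precisely when a larger entry stands
between them. -/
theorem pair_sublist_stackSort {π : List ℕ} (hπ : π.Nodup) {a b : ℕ} (hab : a < b) :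
    [b, a].Sublist (stackSort π) ↔ ∃ c, b < c ∧ [b, c, a].Sublist π := by
  refine nodup_induction (P := fun π => [b, a].Sublist (stackSort π) ↔
    ∃ c, b < c ∧ [b, c, a].Sublist π) (by simp [stackSort]) ?_ π hπ
  intro L m R hnd hL hR ihL ihR
  have hndL := (List.nodup_append.1 hnd).1
  have hndR := (List.nodup_cons.1 (List.nodup_append.1 hnd).2.1).2
  rw [stackSort_append_cons hL hR, pair_sublist_append, pair_sublist_append, ihL, ihR,
    List.mem_append, (stackSort_perm hndL).mem_iff, (stackSort_perm hndR).mem_iff]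
  constructor
  · rintro ((⟨c, hc, h⟩ | ⟨hb, ha⟩ | ⟨c, hc, h⟩) | ⟨hb, ha⟩ | h)
    · exact ⟨c, hc, h.trans (List.sublist_append_left _ _)⟩
    -- With `b` to the left and `a` to the right of the maximum, the maximum itself is the
    -- separating entry.
    · refine ⟨m, hL b hb, ?_⟩
      exact (List.singleton_sublist.2 hb).append ((List.singleton_sublist.2 ha).cons_cons m)
    · exact ⟨c, hc, h.trans ((List.sublist_cons_self _ _).trans (List.sublist_append_right _ _))⟩
    · rw [List.mem_singleton] at ha
      subst ha
      rcases hb with hb | hb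
      · exact absurd (hL _ hb) (not_lt.2 hab.le)
      · exact absurd (hR _ ((stackSort_perm hndR).mem_iff.1 hb)) (not_lt.2 hab.le)
    · have := h.length_le
      simp at this
  · rintro ⟨c, hc, h⟩
    have hbc : [b, c].Sublist (L ++ m :: R) :=
      List.Sublist.trans (List.Sublist.append_left (l₂ := [c, a]) (l₁ := [c]) (by simp) [b]) h
    have hca : [c, a].Sublist (L ++ m :: R) := (List.sublist_cons_self _ _).trans h
    have hmax : c ≤ m := by
      have : c ∈ L ++ m :: R := h.subset (by simp)
      rw [List.mem_append, List.mem_cons] at this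
      rcases this with h | h | h
      · exact (hL _ h).le
      · exact h.le
      · exact (hR _ h).le
    have hRm : ∀ {x y}, [x, y].Sublist (m :: R) → x < m → [x, y].Sublist R := by
      intro x y hxy hx
      rcases List.sublist_cons_iff.1 hxy with h | ⟨r, hr, _⟩
      · exact h
      · simp only [List.cons.injEq] at hr
        omega
    have hRa : ∀ {x y}, [x, y].Sublist (m :: R) → y ∈ R := by
      intro x y hxy
      rcases List.sublist_cons_iff.1 hxy with h | ⟨r, hr, h⟩
      · exact h.subset (by simp)
      · simp only [List.cons.injEq] at hr
        obtain ⟨-, rfl⟩ := hr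
        exact h.subset (by simp)
    have hdis : ∀ {x}, x ∈ L → x ∈ R → False := fun h1 h2 =>
      (List.nodup_append.1 hnd).2.2 _ h1 _ (List.mem_cons_of_mem _ h2) rfl
    rcases pair_sublist_append.1 hbc with h1 | ⟨h1, h2⟩ | h1
    · have hbL : b ∈ L := h1.subset (by simp)
      rcases pair_sublist_append.1 hca with h3 | ⟨h3, h4⟩ | h3
      · exact Or.inl (Or.inl ⟨c, hc, sublist_cons_of_pair hndL h1 h3⟩)
      · have : a ∈ R := by
          rcases List.mem_cons.1 h4 with rfl | h4
          · exact absurd (hL _ hbL) (by omega)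
          · exact h4
        exact Or.inl (Or.inr (Or.inl ⟨hbL, this⟩))
      · exact Or.inl (Or.inr (Or.inl ⟨hbL, hRa h3⟩))
    · rcases pair_sublist_append.1 hca with h3 | ⟨h3, h4⟩ | h3
      · have hcL : c ∈ L := h3.subset (by simp)
        rcases List.mem_cons.1 h2 with rfl | h2
        · exact absurd (hL _ hcL) (lt_irrefl _)
        · exact (hdis hcL h2).elim
      · rcases List.mem_cons.1 h2 with rfl | h2
        · exact absurd (hL _ h3) (lt_irrefl _)
        · exact (hdis h3 h2).elim
      · exact Or.inl (Or.inr (Or.inl ⟨h1, hRa h3⟩))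
    · have hb := hRm h1 (by omega)
      have hcR := hRa h1
      have h3 : [c, a].Sublist R := by
        rcases pair_sublist_append.1 hca with h3 | ⟨h3, h4⟩ | h3
        · exact (hdis (h3.subset (by simp)) hcR).elim
        · exact (hdis h3 hcR).elim
        · exact hRm h3 (hR _ hcR)
      exact Or.inl (Or.inr (Or.inr ⟨c, hc, sublist_cons_of_pair hndR hb h3⟩))

/-- The stack-sorted list avoids `231` and `321` precisely when the list avoids
`2341`, `3241` and `45231`. -/
theorem stackSort_avoids_iff {π : List ℕ} (hπ : π.Nodup) :
    (¬ Contains (stackSort π) [2, 3, 1] ∧ ¬ Contains (stackSort π) [3, 2, 1]) ↔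
      ¬ Contains π [2, 3, 4, 1] ∧ ¬ Contains π [3, 2, 4, 1] ∧ ¬ Contains π [4, 5, 2, 3, 1] := by
  have hs : (stackSort π).Nodup := (stackSort_perm hπ).nodup_iff.2 hπ
  -- Together, 231 and 321 say only that two larger entries `b < b'` precede `a`; their mutual order
  -- is irrelevant.
  have key : (Contains (stackSort π) [2, 3, 1] ∨ Contains (stackSort π) [3, 2, 1]) ↔
      ∃ a b b', a < b ∧ b < b' ∧ [b, a].Sublist (stackSort π) ∧
        [b', a].Sublist (stackSort π) := by
    rw [contains_231_iff, contains_321_iff]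
    have aux : ∀ {x y z : ℕ} {l : List ℕ}, [x, y, z].Sublist l →
        [x, z].Sublist l ∧ [y, z].Sublist l := fun h =>
      ⟨List.Sublist.trans (List.Sublist.append_left (l₁ := [_]) (l₂ := [_, _])
        (List.sublist_cons_self _ _) [_]) h, (List.sublist_cons_self _ _).trans h⟩
    constructor
    · rintro (⟨b, b', a, h, h1, h2⟩ | ⟨b', b, a, h, h1, h2⟩)
      · exact ⟨a, b, b', h1, h2, (aux h).1, (aux h).2⟩
      · exact ⟨a, b, b', h1, h2, (aux h).2, (aux h).1⟩
    · rintro ⟨a, b, b', h1, h2, h3, h4⟩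
      rcases triple_sublist_or hs h3 h4 h2.ne with h | h
      · exact Or.inl ⟨b, b', a, h, h1, h2⟩
      · exact Or.inr ⟨b', b, a, h, h1, h2⟩
  rw [← not_or, key, ← not_or, ← not_or, not_iff_not, contains_2341_iff, contains_3241_iff,
    contains_45231_iff]
  have sub : ∀ {l l' : List ℕ}, l'.Sublist π → l.Sublist l' → l.Sublist π :=
    fun h h' => h'.trans h
  constructor
  · rintro ⟨a, b, b', h1, h2, h3, h4⟩
    rw [pair_sublist_stackSort hπ h1] at h3
    rw [pair_sublist_stackSort hπ (h1.trans h2)] at h4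
    obtain ⟨c, hc, h3⟩ := h3
    obtain ⟨c', hc', h4⟩ := h4
    have hbc : [b, c].Sublist π := sub h3 (by simp)
    have hbc' : [b', c'].Sublist π := sub h4 (by simp)
    have hca : [c, a].Sublist π := sub h3 (by simp)
    have hca' : [c', a].Sublist π := sub h4 (by simp)
    have hbm : b ∈ π := hbc.subset (by simp)
    have hcm' : c' ∈ π := hbc'.subset (by simp)
    -- If `b` precedes `c'`, then `b` and `b'`, in either order, followed by `c'` and `a` form 2341
    -- or 3241. Otherwise the order is `b' c' b c a`, and comparing `b'` with `c` gives 3241 or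
    -- 45231.
    rcases pair_sublist_or hbm hcm' (by omega) with h | h
    · rcases triple_sublist_or hπ h hbc' h2.ne with h5 | h5
      · refine Or.inl ⟨b, b', c', a, ?_, h1, h2, hc'⟩
        exact sublist_cons_of_pair hπ (sub h5 (by simp)) h4
      · refine Or.inr (Or.inl ⟨b', b, c', a, ?_, h1, h2, hc'⟩)
        exact sublist_cons_of_pair hπ (sub h5 (by simp)) (sublist_cons_of_pair hπ h hca')
    · have h5 : [b', c', b, c, a].Sublist π :=
        sublist_cons_of_pair hπ hbc' (sublist_cons_of_pair hπ h h3)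
      rcases lt_or_ge b' c with h6 | h6
      · exact Or.inr (Or.inl ⟨b', b, c, a, sub h5 (by simp), h1, h2, h6⟩)
      · have hnd := hπ.sublist h5
        have : b' ≠ c := by
          rintro rfl
          simp at hnd
        exact Or.inr (Or.inr ⟨b', c', b, c, a, h5, h1, hc, by omega, hc'⟩)
  · rintro (⟨b, b', c, a, h, h1, h2, h3⟩ | ⟨b', b, c, a, h, h1, h2, h3⟩ |
      ⟨b', c', b, c, a, h, h1, h2, h3, h4⟩)
    · refine ⟨a, b, b', h1, h2, ?_, ?_⟩
      · exact (pair_sublist_stackSort hπ h1).2 ⟨c, by omega, sub h (by simp)⟩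
      · exact (pair_sublist_stackSort hπ (by omega)).2 ⟨c, by omega, sub h (by simp)⟩
    · refine ⟨a, b, b', h1, h2, ?_, ?_⟩
      · exact (pair_sublist_stackSort hπ h1).2 ⟨c, by omega, sub h (by simp)⟩
      · exact (pair_sublist_stackSort hπ (by omega)).2 ⟨c, by omega, sub h (by simp)⟩
    · refine ⟨a, b, b', h1, by omega, ?_, ?_⟩
      · exact (pair_sublist_stackSort hπ h1).2 ⟨c, by omega, sub h (by simp)⟩
      · exact (pair_sublist_stackSort hπ (by omega)).2 ⟨c', by omega, sub h (by simp)⟩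

theorem stackPreimage_Av :
    stackPreimage (Av {[2, 3, 1], [3, 2, 1]}) =
      Av {[2, 3, 4, 1], [3, 2, 4, 1], [4, 5, 2, 3, 1]} := by
  ext σ
  have hlen : σ.Nodup → (stackSort σ).length = σ.length := fun h => (stackSort_perm h).length_eq
  have hS : σ.Nodup → ∀ n, stackSort σ ∈ S n ↔ σ ∈ S n := fun h n =>
    ⟨fun h' => (stackSort_perm h).symm.trans h', fun h' => (stackSort_perm h).trans h'⟩
  simp only [stackPreimage, Set.mem_ofPred_eq, mem_Av_iff, Set.mem_insert_iff,
    Set.mem_singleton_iff, forall_eq_or_imp, forall_eq]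
  constructor
  · rintro ⟨h1, h2, h3⟩
    rw [hlen h1.1, hS h1.1] at h2
    exact ⟨h2, (stackSort_avoids_iff h1.1).1 h3⟩
  · rintro ⟨h1, h2⟩
    have h := isPermutation_of_mem_S h1
    rw [hlen h.1, hS h.1]
    exact ⟨h, h1, (stackSort_avoids_iff h.1).2 h2⟩

theorem stackPreimage_Av_inter_S (n : ℕ) :
    stackPreimage (Av {[2, 3, 1], [3, 2, 1]} ∩ S n) =
      Av {[2, 3, 4, 1], [3, 2, 4, 1], [4, 5, 2, 3, 1]} ∩ S n := by
  rw [← stackPreimage_Av]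
  ext σ
  constructor
  · rintro ⟨h1, h2, h3⟩
    exact ⟨⟨h1, h2⟩, (stackSort_perm h1.1).symm.trans h3⟩
  · rintro ⟨⟨h1, h2⟩, h3⟩
    exact ⟨h1, h2, (stackSort_perm h1.1).trans h3⟩

/-! ### Inserting a new minimum -/

/-- Add one to each entry and insert the new smallest entry `1` behind the first `i` entries. -/
def insertMin (i : ℕ) (π : List ℕ) : List ℕ :=
  (π.take i).map Nat.succ ++ 1 :: (π.drop i).map Nat.succ

theorem insertMin_append_left {σ τ : List ℕ} :
    insertMin σ.length (σ ++ τ) = σ.map Nat.succ ++ 1 :: τ.map Nat.succ := by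
  simp [insertMin]

theorem insertMin_append {σ τ : List ℕ} {i : ℕ} (hi : i ≤ σ.length) :
    insertMin i (σ ++ τ) = insertMin i σ ++ τ.map Nat.succ := by
  simp [insertMin, List.take_append_of_le_length hi, List.drop_append_of_le_length hi]

theorem map_succ_sublist_insertMin (i : ℕ) (π : List ℕ) :
    (π.map Nat.succ).Sublist (insertMin i π) := by
  conv_lhs => rw [← List.take_append_drop i π, List.map_append]
  exact List.Sublist.append_left (List.sublist_cons_self _ _) _

theorem insertMin_perm (i : ℕ) (π : List ℕ) :
    (insertMin i π).Perm (1 :: π.map Nat.succ) := by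
  refine List.perm_middle.trans (List.Perm.cons _ ?_)
  rw [← List.map_append, List.take_append_drop]

theorem pos_of_mem_insertMin {i : ℕ} {π : List ℕ} : ∀ a ∈ insertMin i π, 0 < a := by
  intro a ha
  rw [(insertMin_perm i π).mem_iff, List.mem_cons, List.mem_map] at ha
  rcases ha with rfl | ⟨b, -, rfl⟩ <;> simp

theorem range'_one_succ (n : ℕ) :
    List.range' 1 (n + 1) = 1 :: (List.range' 1 n).map Nat.succ := by
  rw [List.range'_succ]
  congr 1
  have : Nat.succ = (1 + ·) := by funext x; simp [Nat.add_comm]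
  rw [this, List.map_add_range']

theorem insertMin_mem_S {n i : ℕ} {π : List ℕ} (h : π ∈ S n) : insertMin i π ∈ S (n + 1) := by
  refine (insertMin_perm i π).trans ?_
  rw [range'_one_succ]
  exact List.Perm.cons _ (List.Perm.map _ h)

theorem exists_eq_insertMin {n : ℕ} {π : List ℕ} (h : π ∈ S (n + 1)) :
    ∃ ρ ∈ S n, ∃ i ≤ n, π = insertMin i ρ := by
  obtain ⟨s, t, rfl⟩ := List.append_of_mem ((mem_iff_of_mem_S h).2 ⟨le_rfl, by omega⟩ : 1 ∈ π)
  have hp : (s ++ t).Perm ((List.range' 1 n).map Nat.succ) := by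
    have h' : (1 :: (s ++ t)).Perm (List.range' 1 (n + 1)) := List.perm_middle.symm.trans h
    rw [range'_one_succ] at h'
    exact List.Perm.cons_inv h'
  have hpos : ∀ a ∈ s ++ t, 1 ≤ a := by
    intro a ha
    obtain ⟨b, -, rfl⟩ := List.mem_map.1 (hp.mem_iff.1 ha)
    simp
  have hmap : ∀ u : List ℕ, (∀ a ∈ u, 1 ≤ a) → (u.map Nat.pred).map Nat.succ = u := by
    intro u hu
    rw [List.map_map]
    conv_rhs => rw [← List.map_id u]
    refine List.map_congr_left fun a ha => ?_
    have := hu a ha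
    simp only [Function.comp_apply, id_eq, Nat.pred_eq_sub_one]
    omega
  refine ⟨(s ++ t).map Nat.pred, ?_, s.length, ?_, ?_⟩
  · have := List.Perm.map Nat.pred hp
    rw [List.map_map] at this
    have h2 : Nat.pred ∘ Nat.succ = id := rfl
    rwa [h2, List.map_id] at this
  · have := length_of_mem_S h
    simp at this
    omega
  · have h1 := insertMin_append_left (σ := s.map Nat.pred) (τ := t.map Nat.pred)
    rw [List.length_map] at h1
    rw [List.map_append, h1, hmap s fun a ha => hpos a (List.mem_append_left _ ha),
      hmap t fun a ha => hpos a (List.mem_append_right _ ha)]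

/-- The position of 1 recovers the site, and erasing 1 recovers the shifted permutation. Hence each
permutation arises only once in the growth process. -/
theorem insertMin_inj {i j : ℕ} {π ρ : List ℕ} (hπ : ∀ a ∈ π, 0 < a) (hρ : ∀ a ∈ ρ, 0 < a)
    (hi : i ≤ π.length) (hj : j ≤ ρ.length) (h : insertMin i π = insertMin j ρ) :
    i = j ∧ π = ρ := by
  have hnot : ∀ {u : List ℕ} {k : ℕ}, (∀ a ∈ u, 0 < a) → 1 ∉ (u.take k).map Nat.succ := by
    intro u k hu h1
    obtain ⟨b, hb, hb'⟩ := List.mem_map.1 h1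
    have := hu b (List.mem_of_mem_take hb)
    omega
  have hidx : ∀ {u : List ℕ} {k : ℕ}, (∀ a ∈ u, 0 < a) → k ≤ u.length →
      (insertMin k u).idxOf 1 = k := by
    intro u k hu hk
    rw [insertMin, List.idxOf_append_of_notMem (hnot hu)]
    simp [hk]
  have herase : ∀ {u : List ℕ} {k : ℕ}, (∀ a ∈ u, 0 < a) →
      (insertMin k u).erase 1 = u.map Nat.succ := by
    intro u k hu
    rw [insertMin, List.erase_append_right _ (hnot hu), List.erase_cons_head, ← List.map_append,
      List.take_append_drop]
  refine ⟨?_, ?_⟩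
  · rw [← hidx hπ hi, h, hidx hρ hj]
  · have := (herase hπ).symm.trans ((congrArg (List.erase · 1) h).trans (herase (k := j) hρ))
    exact List.map_injective_iff.2 Nat.succ_injective this

/-! ### Growing a class along its longest free prefixes -/

section Classes

variable (Occ : List ℕ → Prop)

/-- No sublist satisfies `Occ`. -/
def Free (σ : List ℕ) : Prop := ∀ l : List ℕ, l.Sublist σ → ¬ Occ l

/-- No sublist satisfying `Occ` is followed by an entry smaller than all its entries. -/
def FreeAbove (π : List ℕ) : Prop :=
  ∀ (l : List ℕ) (d : ℕ), (l ++ [d]).Sublist π → (∀ a ∈ l, d < a) → ¬ Occ l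

/-- `σ` is the longest prefix of `π` that is free of `Occ`. -/
def IsMaxPrefix (σ π : List ℕ) : Prop :=
  ∃ τ, π = σ ++ τ ∧ Free Occ σ ∧ ∀ t τ', τ = t :: τ' → ¬ Free Occ (σ ++ [t])

variable {Occ}

theorem Free.sublist {σ σ' : List ℕ} (h : Free Occ σ) (hs : σ'.Sublist σ) : Free Occ σ' :=
  fun l hl => h l (hl.trans hs)

theorem free_map_succ_iff (hocc : ∀ l, Occ (l.map Nat.succ) ↔ Occ l) {σ : List ℕ} :
    Free Occ (σ.map Nat.succ) ↔ Free Occ σ := by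
  constructor
  · intro h l hl hl'
    exact h _ (hl.map _) ((hocc l).2 hl')
  · intro h l hl hl'
    obtain ⟨l', hl1, rfl⟩ := List.sublist_map_iff.1 hl
    exact h _ hl1 ((hocc _).1 hl')

/-- The new minimum cannot lie above another entry, so in a forbidden configuration it can only be
the final smallest entry. This happens exactly when an occurrence lies entirely before it. -/
theorem freeAbove_insertMin_iff (hocc : ∀ l, Occ (l.map Nat.succ) ↔ Occ l) {π : List ℕ}
    {i : ℕ} (hπ : ∀ a ∈ π, 0 < a) :
    FreeAbove Occ (insertMin i π) ↔ FreeAbove Occ π ∧ Free Occ (π.take i) := by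
  constructor
  · intro h
    refine ⟨fun l d hl hd ho => ?_, fun l hl ho => ?_⟩
    · refine h (l.map Nat.succ) (d + 1) ?_ ?_ ((hocc l).2 ho)
      · have := hl.map Nat.succ
        rw [List.map_append] at this
        exact this.trans (map_succ_sublist_insertMin i π)
      · intro a ha
        obtain ⟨b, hb, rfl⟩ := List.mem_map.1 ha
        exact Nat.succ_lt_succ (hd b hb)
    · refine h (l.map Nat.succ) 1 ?_ ?_ ((hocc l).2 ho)
      · exact (hl.map _).append (List.singleton_sublist.2 (by simp))
      · intro a ha
        obtain ⟨b, hb, rfl⟩ := List.mem_map.1 ha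
        exact Nat.succ_lt_succ (hπ b (List.mem_of_mem_take (hl.subset hb)))
  · rintro ⟨h1, h2⟩ l d hl hd ho
    have hge : ∀ {a}, a ∈ insertMin i π → 0 < a := fun ha => pos_of_mem_insertMin _ ha
    have hd0 : 0 < d := hge (hl.subset (by simp))
    have hpos1 : ∀ k, ∀ a ∈ (π.take k).map Nat.succ, 1 < a := by
      intro k a ha
      obtain ⟨b, hb, rfl⟩ := List.mem_map.1 ha
      exact Nat.succ_lt_succ (hπ b (List.mem_of_mem_take hb))
    rw [insertMin, List.sublist_append_iff] at hl
    obtain ⟨l₁, l₂, hl12, hl1, hl2⟩ := hl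
    have h1l : 1 ∉ l := fun h => by have := hd 1 h; omega
    rcases List.sublist_cons_iff.1 hl2 with hl2 | ⟨r, rfl, hr⟩
    · have : (l ++ [d]).Sublist (π.map Nat.succ) := by
        rw [hl12]
        have := hl1.append hl2
        rwa [← List.map_append, List.take_append_drop] at this
      obtain ⟨l', hl', hl''⟩ := List.sublist_map_iff.1 this
      obtain ⟨u, v, rfl, rfl, hv⟩ := List.append_eq_map_iff.1 hl''
      obtain ⟨e, rfl, rfl⟩ : ∃ e, v = [e] ∧ d = e + 1 := by
        match v, hv with
        | [e], hv => exact ⟨e, rfl, by simpa using hv.symm⟩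
      refine h1 u e hl' (fun a ha => ?_) ((hocc u).1 ho)
      have := hd (a + 1) (List.mem_map.2 ⟨a, ha, rfl⟩)
      omega
    · have hr0 : r = [] := by
        rcases List.eq_nil_or_concat r with rfl | ⟨r', e, rfl⟩
        · rfl
        · exfalso
          have h3 : l = l₁ ++ 1 :: r' := by
            have : l ++ [d] = (l₁ ++ 1 :: r') ++ [e] := by rw [hl12]; simp
            exact (List.append_inj' this rfl).1
          exact h1l (h3 ▸ by simp)
      subst hr0
      have h3 : l = l₁ := (List.append_inj' hl12 rfl).1
      subst h3
      exact (free_map_succ_iff hocc).2 h2 _ hl1 ho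

/-- Freeness passes to shorter prefixes, so the allowed sites form an initial interval ending at
`σ.length`. -/
theorem IsMaxPrefix.free_take_iff {σ π : List ℕ} (h : IsMaxPrefix Occ σ π) {i : ℕ}
    (hi : i ≤ π.length) : Free Occ (π.take i) ↔ i ≤ σ.length := by
  obtain ⟨τ, rfl, h1, h2⟩ := h
  constructor
  · intro hf
    by_contra! hlt
    match τ, h2 with
    | [], _ => simp at hi; omega
    | t :: τ', h2 =>
      refine h2 t τ' rfl (hf.sublist ?_)
      have : σ ++ [t] = (σ ++ t :: τ').take (σ.length + 1) := by
        simp [List.take_append]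
      rw [this]
      exact (List.take_prefix_take_left (by omega)).sublist
  · intro hle
    rw [List.take_append_of_le_length hle]
    exact h1.sublist (List.take_sublist _ _)

/-- An occurrence that stops `σ` from being extended survives the insertion, so what lies beyond `σ`
cannot influence the new longest free prefix. -/
theorem IsMaxPrefix.insertMin (hocc : ∀ l, Occ (l.map Nat.succ) ↔ Occ l) {σ π σ' : List ℕ}
    {i : ℕ} (h : IsMaxPrefix Occ σ π) (hi : i ≤ σ.length)
    (h' : IsMaxPrefix Occ σ' (insertMin i σ)) : IsMaxPrefix Occ σ' (insertMin i π) := by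
  obtain ⟨τ, rfl, h1, h2⟩ := h
  obtain ⟨ρ, h3, h4, h5⟩ := h'
  rw [insertMin_append hi, h3]
  refine ⟨ρ ++ τ.map Nat.succ, by simp, h4, ?_⟩
  intro t τ' ht hf
  cases ρ with
  | cons r ρ =>
    rw [List.cons_append, List.cons.injEq] at ht
    exact h5 t ρ (by rw [ht.1]) hf
  | nil =>
    -- If all of `insertMin i σ` is free, the next entry is the shift of the one that already
    -- blocked `σ`.
    obtain ⟨e, τ'', rfl, rfl, -⟩ := List.map_eq_cons_iff.1 ht
    refine h2 e τ'' rfl ((free_map_succ_iff hocc).1 (hf.sublist ?_))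
    rw [List.append_nil] at h3
    rw [← h3, List.map_append]
    exact (map_succ_sublist_insertMin i σ).append (List.Sublist.refl _)

open Classical in
variable (Occ) in
/-- The rearrangements of `1, …, n` that satisfy `FreeAbove Occ`, built by inserting minima. -/
noncomputable def permClass : ℕ → Finset (List ℕ)
  | 0 => {[]}
  | n + 1 => (permClass n).biUnion fun π =>
      ((Finset.range (π.length + 1)).filter fun i => Free Occ (π.take i)).image (insertMin · π)

theorem mem_permClass_iff (hocc : ∀ l, Occ (l.map Nat.succ) ↔ Occ l)
    {n : ℕ} {π : List ℕ} : π ∈ permClass Occ n ↔ π ∈ S n ∧ FreeAbove Occ π := by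
  induction n generalizing π with
  | zero =>
    rw [permClass, Finset.mem_singleton]
    constructor
    · rintro rfl
      refine ⟨by simp [S], fun l d hl => by simp at hl⟩
    · rintro ⟨h, -⟩
      exact List.eq_nil_of_length_eq_zero (length_of_mem_S h)
  | succ n ih =>
    simp only [permClass, Finset.mem_biUnion, Finset.mem_image, Finset.mem_filter,
      Finset.mem_range, ih]
    constructor
    · rintro ⟨ρ, ⟨h1, h2⟩, i, ⟨h3, h4⟩, rfl⟩
      exact ⟨insertMin_mem_S h1,
        (freeAbove_insertMin_iff hocc (isPermutation_of_mem_S h1).2).2 ⟨h2, h4⟩⟩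
    · rintro ⟨h1, h2⟩
      obtain ⟨ρ, hρ, i, hi, rfl⟩ := exists_eq_insertMin h1
      rw [freeAbove_insertMin_iff hocc (isPermutation_of_mem_S hρ).2] at h2
      exact ⟨ρ, ⟨hρ, h2.1⟩, i, ⟨by rw [length_of_mem_S hρ]; omega, h2.2⟩, rfl⟩

open Classical in
variable (Occ) in
/-- The number of ways to insert `m` minima one after the other. -/
noncomputable def descendants : ℕ → List ℕ → ℕ
  | 0, _ => 1
  | m + 1, π => ∑ i ∈ (Finset.range (π.length + 1)).filter fun i => Free Occ (π.take i),
      descendants m (insertMin i π)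

/-- One level of the sum is traded for one further insertion; uniqueness of the insertion makes the
unions disjoint. -/
theorem sum_descendants (hocc : ∀ l, Occ (l.map Nat.succ) ↔ Occ l) (n m : ℕ) :
    ∑ π ∈ permClass Occ n, descendants Occ m π = descendants Occ (m + n) [] := by
  classical
  induction n generalizing m with
  | zero => simp [permClass]
  | succ n ih =>
    have hpos : ∀ π ∈ permClass Occ n, ∀ a ∈ π, 0 < a := fun π hπ =>
      (isPermutation_of_mem_S ((mem_permClass_iff hocc).1 hπ).1).2
    rw [permClass, Finset.sum_biUnion]
    · rw [show m + (n + 1) = (m + 1) + n by omega, ← ih (m + 1)]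
      refine Finset.sum_congr rfl fun π hπ => ?_
      rw [Finset.sum_image]
      · rw [descendants]
      · intro i hi j hj hij
        simp only [Finset.coe_filter, Finset.mem_range, Set.mem_ofPred_eq] at hi hj
        exact (insertMin_inj (hpos π hπ) (hpos π hπ) (by omega) (by omega) hij).1
    · intro π hπ ρ hρ hne
      rw [Function.onFun, Finset.disjoint_left]
      intro σ h1 h2
      simp only [Finset.mem_image, Finset.mem_filter, Finset.mem_range] at h1 h2
      obtain ⟨i, ⟨hi, -⟩, rfl⟩ := h1
      obtain ⟨j, ⟨hj, -⟩, h⟩ := h2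
      exact hne (insertMin_inj (hpos ρ hρ) (hpos π hπ) (by omega) (by omega) h).2.symm

/-- If the possible longest free prefixes are described by shapes `(s, q)`, and inserting a
minimum transforms the shapes by the rule of the generating tree, then the class is counted by
the generating tree. -/
theorem card_permClass (hocc : ∀ l, Occ (l.map Nat.succ) ↔ Occ l) (hnil : ¬ Occ [])
    (Shape : ℕ → ℕ → List ℕ → Prop) (child : ℕ → ℕ → ℕ → ℕ × ℕ)
    (hchild : ∀ (s q : ℕ) (f : ℕ → ℕ → ℕ), (∃ σ, Shape s q σ) →
      ∑ i ∈ Finset.range (q + s + 1), f (child s q i).1 (child s q i).2 =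
      ∑ i ∈ Finset.range (q + 1), f (q - i) (i + 1) + ∑ j ∈ Finset.range s, f (j + 2) q)
    (hroot : Shape 0 0 [])
    (hlen : ∀ s q σ, Shape s q σ → σ.length = q + s)
    (hstep : ∀ s q σ, Shape s q σ → (∀ a ∈ σ, 0 < a) → ∀ i ≤ q + s, ∃ σ',
      Shape (child s q i).1 (child s q i).2 σ' ∧ IsMaxPrefix Occ σ' (insertMin i σ))
    (n : ℕ) : (permClass Occ n).card = treeCount n 0 0 := by
  classical
  have key : ∀ m s q π σ, (∀ a ∈ π, 0 < a) → Shape s q σ → IsMaxPrefix Occ σ π →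
      descendants Occ m π = treeCount m s q := by
    intro m
    induction m with
    | zero => intros; simp [descendants, treeCount]
    | succ m ih =>
      intro s q π σ hπ hσ hmax
      have hle : q + s ≤ π.length := by
        obtain ⟨τ, rfl, -⟩ := hmax
        rw [← hlen s q σ hσ, List.length_append]
        omega
      rw [descendants, treeCount, ← hchild s q _ ⟨σ, hσ⟩]
      refine Finset.sum_congr ?_ fun i hi => ?_
      · ext i
        rw [Finset.mem_filter, Finset.mem_range, Finset.mem_range]
        constructor
        · rintro ⟨h1, h2⟩
          rw [hmax.free_take_iff (by omega), hlen s q σ hσ] at h2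
          omega
        · intro h
          refine ⟨by omega, ?_⟩
          rw [hmax.free_take_iff (by omega), hlen s q σ hσ]
          omega
      · have hi' : i ≤ q + s := by have := Finset.mem_range.1 hi; omega
        have hσpos : ∀ a ∈ σ, 0 < a := by
          obtain ⟨τ, rfl, -⟩ := hmax
          exact fun a ha => hπ a (List.mem_append_left _ ha)
        obtain ⟨σ', h1, h2⟩ := hstep s q σ hσ hσpos i hi'
        exact ih _ _ _ σ' pos_of_mem_insertMin h1
          (hmax.insertMin hocc (by rw [hlen s q σ hσ]; exact hi') h2)
  have hmax : IsMaxPrefix Occ [] [] := by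
    refine ⟨[], rfl, fun l hl => ?_, by simp⟩
    rw [List.sublist_nil] at hl
    exact hl ▸ hnil
  have h := sum_descendants hocc n 0
  rw [zero_add, key n 0 0 [] [] (by simp) hroot hmax] at h
  simpa [descendants] using h

theorem exists_insertMin_eq {σ : List ℕ} {i : ℕ} (hi : i ≤ σ.length) :
    ∃ A B, σ = A ++ B ∧ A.length = i ∧
      insertMin i σ = A.map Nat.succ ++ 1 :: B.map Nat.succ :=
  ⟨σ.take i, σ.drop i, (List.take_append_drop i σ).symm, by simp [hi], rfl⟩

end Classes

/-! ### The class Av(2341, 3241, 45231) -/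

/-- Occurrences of the patterns `123`, `213` and `3412`. -/
def OccA (l : List ℕ) : Prop :=
  (∃ a b c, l = [a, b, c] ∧ ((a < b ∧ b < c) ∨ (b < a ∧ a < c))) ∨
    ∃ a b c d, l = [a, b, c, d] ∧ c < d ∧ d < a ∧ a < b

theorem occA_map_succ (l : List ℕ) : OccA (l.map Nat.succ) ↔ OccA l := by
  match l with
  | [] | [_] | [_, _] | [_, _, _] | [_, _, _, _] | _ :: _ :: _ :: _ :: _ :: _ => simp [OccA]

/-- The lists obtained from a decreasing list by moving one entry to the left. -/
def ShapeA (s q : ℕ) (σ : List ℕ) : Prop :=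
  (s = 0 ∧ q = 0 ∧ σ = []) ∨
    ∃ U x K V, σ = U ++ x :: (K ++ V) ∧ (U ++ K ++ x :: V).Pairwise (· > ·) ∧
      (K ≠ [] ∨ V = []) ∧ q = U.length + 1 ∧ s = K.length + V.length

theorem ascent_of_moved {U K V : List ℕ} {x a c : ℕ}
    (h : (U ++ K ++ x :: V).Pairwise (· > ·)) (hac : [a, c].Sublist (U ++ x :: (K ++ V)))
    (hlt : a < c) : a = x := by
  simp only [List.append_assoc, List.pairwise_append, List.pairwise_cons, List.mem_append,
    List.mem_cons] at h
  obtain ⟨hU, ⟨hK, ⟨hxV, hV⟩, hKV⟩, hUU⟩ := h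
  have pw : ∀ {l : List ℕ}, l.Pairwise (· > ·) → [a, c].Sublist l → False := by
    intro l hl hs
    have := hl.sublist hs
    simp at this
    omega
  rcases pair_sublist_append.1 hac with h1 | ⟨h1, h2⟩ | h1
  · exact (pw hU h1).elim
  · have := hUU a h1 c (by
      simp only [List.mem_append, List.mem_cons] at h2
      tauto)
    omega
  · rcases List.sublist_cons_iff.1 h1 with h1 | ⟨r, hr, -⟩
    · refine (pw (l := K ++ V) ?_ h1).elim
      exact List.pairwise_append.2 ⟨hK, hV, fun a ha b hb => hKV a ha b (Or.inr hb)⟩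
    · simp only [List.cons.injEq] at hr
      exact hr.1

/-- All ascending pairs start at the moved entry, but each of 123, 213, 3412 has ascending pairs
with two different first entries. -/
theorem ShapeA.free {s q : ℕ} {σ : List ℕ} (h : ShapeA s q σ) : Free OccA σ := by
  intro l hl hocc
  rcases h with ⟨-, -, rfl⟩ | ⟨U, x, K, V, rfl, hp, -⟩
  · rw [List.sublist_nil] at hl
    subst hl
    simp [OccA] at hocc
  · have key : ∀ {a c}, [a, c].Sublist l → a < c → a = x := fun h1 h2 =>
      ascent_of_moved hp (h1.trans hl) h2
    rcases hocc with ⟨a, b, c, rfl, h⟩ | ⟨a, b, c, d, rfl, h⟩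
    · have h1 := key (a := a) (c := c) (by simp) (by omega)
      have h2 := key (a := b) (c := c) (by simp) (by omega)
      omega
    · have h1 := key (a := a) (c := b) (by simp) (by omega)
      have h2 := key (a := c) (c := d) (by simp) (by omega)
      omega

theorem ShapeA.length_eq {s q : ℕ} {σ : List ℕ} (h : ShapeA s q σ) : σ.length = q + s := by
  rcases h with ⟨rfl, rfl, rfl⟩ | ⟨U, x, K, V, rfl, -, -, rfl, rfl⟩
  · rfl
  · simp only [List.length_append, List.length_cons]
    omega

/-- The shape after inserting a minimum behind `i` entries. -/
def childA (_s q i : ℕ) : ℕ × ℕ := if i ≤ q then (q - i, i + 1) else (i - q + 1, q)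

theorem sum_childA (s q : ℕ) (f : ℕ → ℕ → ℕ) :
    ∑ i ∈ Finset.range (q + s + 1), f (childA s q i).1 (childA s q i).2 =
      ∑ i ∈ Finset.range (q + 1), f (q - i) (i + 1) + ∑ j ∈ Finset.range s, f (j + 2) q := by
  rw [show q + s + 1 = (q + 1) + s by omega, Finset.sum_range_add]
  congr 1
  · refine Finset.sum_congr rfl fun i hi => ?_
    rw [childA, if_pos (by have := Finset.mem_range.1 hi; omega)]
  · refine Finset.sum_congr rfl fun j _ => ?_
    rw [childA, if_neg (by omega)]
    congr 1
    simp only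
    omega

theorem isMaxPrefix_of_shapeA {s q : ℕ} {σ ρ : List ℕ} (h : ShapeA s q σ)
    (hρ : ∀ t ρ', ρ = t :: ρ' → ∃ l : List ℕ, l.Sublist (σ ++ [t]) ∧ OccA l) :
    IsMaxPrefix OccA σ (σ ++ ρ) :=
  ⟨ρ, rfl, h.free, fun t ρ' ht hf => by
    obtain ⟨l, h1, h2⟩ := hρ t ρ' ht
    exact hf l h1 h2⟩

/-- Let `k` be in `K` and `v` in `V`, so `v < x < k`. A minimum placed before `x` becomes the moved
entry, and the free prefix ends at `x`, since `1, x, k` is a 123. Placed behind `x`, it ends the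
free prefix itself: a following `k` gives the 213 `x, 1, k`, and a following `v` gives the 3412 `x,
k, 1, v`. -/
theorem shapeA_insertMin {s q : ℕ} {σ : List ℕ} (h : ShapeA s q σ) (hpos : ∀ a ∈ σ, 0 < a)
    {i : ℕ} (hi : i ≤ q + s) : ∃ σ', ShapeA (childA s q i).1 (childA s q i).2 σ' ∧
      IsMaxPrefix OccA σ' (insertMin i σ) := by
  have hlen := h.length_eq
  rcases h with ⟨rfl, rfl, rfl⟩ | ⟨U, x, K, V, rfl, hp, hKV, rfl, rfl⟩
  · obtain rfl : i = 0 := by omega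
    have h1 : ShapeA 0 1 [1] := Or.inr ⟨[], 1, [], [], by simp⟩
    exact ⟨[1], h1, isMaxPrefix_of_shapeA (ρ := []) h1 (by simp)⟩
  have hp' : ∀ L : List ℕ, L.Sublist (U ++ K ++ x :: V) →
      (L.map Nat.succ ++ [1]).Pairwise (· > ·) := by
    intro L hL
    rw [List.pairwise_append, List.pairwise_map]
    refine ⟨(hp.sublist hL).imp (by intro a b h; omega), by simp, ?_⟩
    intro a ha b hb
    obtain ⟨c, hc, rfl⟩ := List.mem_map.1 ha
    have := hpos c (by
      have := hL.subset hc
      simp only [List.mem_append, List.mem_cons] at this ⊢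
      tauto)
    simp only [List.mem_singleton] at hb
    omega
  have hx : 0 < x := hpos x (by simp)
  have hxK : ∀ k ∈ K, x < k := fun k hk =>
    (List.pairwise_append.1 hp).2.2 k (by simp [hk]) x (by simp)
  have hxV : ∀ v ∈ V, v < x ∧ 0 < v := fun v hv =>
    ⟨(List.pairwise_cons.1 (List.pairwise_append.1 hp).2.1).1 v hv, hpos v (by simp [hv])⟩
  obtain ⟨A, B, hAB, rfl, hins⟩ := exists_insertMin_eq (hlen ▸ hi)
  rw [hins]
  have hsplit : (∃ U₂, U = A ++ U₂ ∧ B = U₂ ++ x :: (K ++ V)) ∨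
      ∃ P, A = U ++ x :: P ∧ K ++ V = P ++ B := by
    rcases List.append_eq_append_iff.1 hAB.symm with h | ⟨A₂, rfl, hA₂⟩
    · exact Or.inl h
    · rcases List.cons_eq_append_iff.1 hA₂ with ⟨rfl, rfl⟩ | ⟨P, rfl, hP⟩
      · exact Or.inl ⟨[], by simp⟩
      · exact Or.inr ⟨P, rfl, hP⟩
  rcases hsplit with ⟨U₂, rfl, rfl⟩ | ⟨P, rfl, hP⟩
  · have h1 : ShapeA (childA (K.length + V.length) ((A ++ U₂).length + 1) A.length).1
        (childA (K.length + V.length) ((A ++ U₂).length + 1) A.length).2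
        (A.map Nat.succ ++ 1 :: (U₂.map Nat.succ ++ [x + 1])) := by
      rw [childA, if_pos (by simp; omega)]
      refine Or.inr ⟨A.map Nat.succ, 1, U₂.map Nat.succ ++ [x + 1], [], by simp, ?_, by simp,
        by simp, by simp; omega⟩
      have := hp' (A ++ U₂ ++ [x]) ?_
      · simpa using this
      · rw [List.append_assoc (A ++ U₂)]
        exact List.Sublist.append_left
          ((List.singleton_sublist.2 (by simp)).trans (List.sublist_append_right _ _)) _
    refine ⟨_, h1, ?_⟩
    have := isMaxPrefix_of_shapeA (ρ := (K ++ V).map Nat.succ) h1 ?_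
    · simpa using this
    · intro t ρ' ht
      have hK : K ≠ [] := by
        rintro rfl
        rcases hKV with h | rfl
        · exact h rfl
        · simp at ht
      obtain ⟨k, K', rfl⟩ := List.exists_cons_of_ne_nil hK
      simp only [List.cons_append, List.map_cons, List.cons.injEq] at ht
      obtain ⟨rfl, -⟩ := ht
      have := hxK k (by simp)
      refine ⟨[1, x + 1, k + 1], ?_, Or.inl ⟨_, _, _, rfl, by omega⟩⟩
      refine List.Sublist.append (l₁ := [1, x + 1]) ?_ (List.Sublist.refl [k + 1])
      exact pair_sublist_append.2 (Or.inr (Or.inr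
        ((List.singleton_sublist.2 (by simp)).cons_cons 1)))
  · have hlenP : K.length + V.length = P.length + B.length := by
      simpa using congrArg List.length hP
    have h213 : ∀ k ∈ K, ∀ P' : List ℕ,
        ∃ l : List ℕ, l.Sublist (U.map Nat.succ ++ (x + 1) :: (P' ++ [1]) ++ [k + 1]) ∧
          OccA l := by
      intro k hk P'
      have := hxK k hk
      refine ⟨[x + 1, 1, k + 1], ?_, Or.inl ⟨_, _, _, rfl, by omega⟩⟩
      refine List.Sublist.append (l₁ := [x + 1, 1]) ?_ (List.Sublist.refl [k + 1])
      exact pair_sublist_append.2 (Or.inr (Or.inr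
        ((List.singleton_sublist.2 (by simp)).cons_cons (x + 1))))
    -- Directly behind `x` the new free prefix is decreasing. Its last entry 1 then plays the role
    -- of the moved entry, as the normal form requires.
    rcases eq_or_ne P [] with rfl | hPne
    · rw [List.nil_append] at hP
      subst hP
      have h1 : ShapeA (childA (K.length + V.length) (U.length + 1) (U ++ [x]).length).1
          (childA (K.length + V.length) (U.length + 1) (U ++ [x]).length).2
          (U.map Nat.succ ++ (x + 1) :: ([] ++ [1])) := by
        rw [childA, if_pos (by simp)]
        refine Or.inr ⟨U.map Nat.succ ++ [x + 1], 1, [], [], by simp, ?_, by simp,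
          by simp, by simp⟩
        have := hp' (U ++ [x]) ?_
        · simpa using this
        · rw [List.append_assoc U]
          exact List.Sublist.append_left
            ((List.singleton_sublist.2 (by simp)).trans (List.sublist_append_right _ _)) _
      refine ⟨_, h1, ?_⟩
      have := isMaxPrefix_of_shapeA (ρ := (K ++ V).map Nat.succ) h1 ?_
      · simpa using this
      · intro t ρ' ht
        have hK : K ≠ [] := by
          rintro rfl
          rcases hKV with h | rfl
          · exact h rfl
          · simp at ht
        obtain ⟨k, K', rfl⟩ := List.exists_cons_of_ne_nil hK
        simp only [List.cons_append, List.map_cons, List.cons.injEq] at ht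
        obtain ⟨rfl, -⟩ := ht
        exact h213 k (by simp) []
    · have hchild : childA (K.length + V.length) (U.length + 1) (U ++ x :: P).length =
          (P.length + 1, U.length + 1) := by
        have := List.length_pos_iff.2 hPne
        rw [childA, if_neg (by simp; omega)]
        simp only [List.length_append, List.length_cons, Prod.mk.injEq, and_true]
        omega
      have h3412 : ∀ k ∈ P, k ∈ K → ∀ v ∈ V,
          ∃ l : List ℕ, l.Sublist (U.map Nat.succ ++ (x + 1) :: (P.map Nat.succ ++ [1]) ++
            [v + 1]) ∧ OccA l := by
        intro k hkP hk v hv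
        have h1 := hxK k hk
        have h2 := hxV v hv
        refine ⟨[x + 1, k + 1, 1, v + 1], ?_, Or.inr ⟨_, _, _, _, rfl, by omega⟩⟩
        refine List.Sublist.append (l₁ := [x + 1, k + 1, 1]) ?_ (List.Sublist.refl [v + 1])
        refine List.Sublist.trans ?_ (List.sublist_append_right _ _)
        refine List.Sublist.cons_cons _ (List.Sublist.append (l₁ := [k + 1]) ?_
          (List.Sublist.refl [1]))
        exact List.singleton_sublist.2 (List.mem_map.2 ⟨k, hkP, rfl⟩)
      rw [hchild]
      rcases List.append_eq_append_iff.1 hP.symm with ⟨K₂, rfl, rfl⟩ | ⟨V₁, rfl, rfl⟩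
      · have h1 : ShapeA (P.length + 1) (U.length + 1)
            (U.map Nat.succ ++ (x + 1) :: (P.map Nat.succ ++ [1])) := by
          refine Or.inr ⟨U.map Nat.succ, x + 1, P.map Nat.succ, [1], by simp, ?_,
            Or.inl (by simpa using hPne), by simp, by simp⟩
          have := hp' (U ++ P ++ [x]) ?_
          · simpa using this
          · refine List.Sublist.append ?_ (List.singleton_sublist.2 (by simp))
            exact List.Sublist.append_left (List.sublist_append_left _ _) _
        refine ⟨_, h1, ?_⟩
        have := isMaxPrefix_of_shapeA (ρ := (K₂ ++ V).map Nat.succ) h1 ?_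
        · simpa using this
        · intro t ρ' ht
          cases K₂ with
          | cons k K₂ =>
            simp only [List.cons_append, List.map_cons, List.cons.injEq] at ht
            obtain ⟨rfl, -⟩ := ht
            exact h213 k (by simp) _
          | nil =>
            cases V with
            | nil => simp at ht
            | cons v V =>
              simp only [List.nil_append, List.map_cons, List.cons.injEq] at ht
              obtain ⟨rfl, -⟩ := ht
              obtain ⟨k, P, rfl⟩ := List.exists_cons_of_ne_nil hPne
              exact h3412 k (by simp) (by simp) v (by simp)
      · have hK : V₁ ≠ [] → K ≠ [] := by
          intro h
          rcases hKV with h' | h'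
          · exact h'
          · simp [h] at h'
        have hKne : K ≠ [] := by
          rintro rfl
          exact hK (by simpa using hPne) rfl
        have h1 : ShapeA ((K ++ V₁).length + 1) (U.length + 1)
            (U.map Nat.succ ++ (x + 1) :: ((K ++ V₁).map Nat.succ ++ [1])) := by
          refine Or.inr ⟨U.map Nat.succ, x + 1, K.map Nat.succ, V₁.map Nat.succ ++ [1],
            by simp, ?_, Or.inl (by simpa using hKne), by simp, by simp; omega⟩
          have := hp' (U ++ K ++ x :: V₁) ?_
          · simpa using this
          · exact List.Sublist.append_left ((List.sublist_append_left _ _).cons_cons _) _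
        refine ⟨_, h1, ?_⟩
        have := isMaxPrefix_of_shapeA (ρ := B.map Nat.succ) h1 ?_
        · simpa using this
        · intro t ρ' ht
          obtain ⟨v, B, rfl, rfl, -⟩ := List.map_eq_cons_iff.1 ht
          obtain ⟨k, K, rfl⟩ := List.exists_cons_of_ne_nil hKne
          exact h3412 k (by simp) (by simp) v (by simp)

theorem card_permClass_occA (n : ℕ) : (permClass OccA n).card = treeCount n 0 0 :=
  card_permClass occA_map_succ (by simp [OccA]) ShapeA childA (fun s q f _ => sum_childA s q f)
    (Or.inl ⟨rfl, rfl, rfl⟩) (fun _ _ _ h => h.length_eq)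
    (fun _ _ _ h hpos _ hi => shapeA_insertMin h hpos hi) n

/-! ### The class Av(4321, 2431) -/

/-- Occurrences of the patterns `321` and `132`. -/
def OccB (l : List ℕ) : Prop :=
  ∃ a b c, l = [a, b, c] ∧ ((c < b ∧ b < a) ∨ (a < c ∧ c < b))

theorem occB_map_succ (l : List ℕ) : OccB (l.map Nat.succ) ↔ OccB l := by
  match l with
  | [] | [_] | [_, _] | [_, _, _] | _ :: _ :: _ :: _ :: _ => simp [OccB]

/-- The lists obtained from an increasing list by interchanging two adjacent blocks, the first
of which starts the list. -/
def ShapeB (s q : ℕ) (σ : List ℕ) : Prop :=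
  ∃ U V W, σ = U ++ (V ++ W) ∧ (V ++ U ++ W).Pairwise (· < ·) ∧
    ((V = [] ∧ W = []) ∨ (U ≠ [] ∧ V ≠ [])) ∧ q = U.length ∧ s = V.length + W.length

/-- Every descending pair leads from `U` to `V`. In both patterns `b, c` descends, so `b` is in `U`.
In 321 the pair `a, b` would put `b` in `V` as well; in 132 the entry `a` lies in `U` too and
exceeds `c`. -/
theorem ShapeB.free {s q : ℕ} {σ : List ℕ} (h : ShapeB s q σ) : Free OccB σ := by
  rintro l hl ⟨a, b, c, rfl, h'⟩
  obtain ⟨U, V, W, rfl, hp, -⟩ := h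
  simp only [List.append_assoc, List.pairwise_append, List.mem_append] at hp
  obtain ⟨hV, ⟨hU, hW, hUW⟩, hVV⟩ := hp
  have pw : ∀ {l : List ℕ} {x y : ℕ}, l.Pairwise (· < ·) → [x, y].Sublist l → x < y := by
    intro l x y hl hs
    simpa using hl.sublist hs
  have hVW : (V ++ W).Pairwise (· < ·) :=
    List.pairwise_append.2 ⟨hV, hW, fun a ha b hb => hVV a ha b (Or.inr hb)⟩
  have descent : ∀ {x y}, [x, y].Sublist (U ++ (V ++ W)) → y < x → x ∈ U ∧ y ∈ V := by
    intro x y hs hlt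
    rcases pair_sublist_append.1 hs with h1 | ⟨h1, h2⟩ | h1
    · have := pw hU h1
      omega
    · refine ⟨h1, ?_⟩
      rcases List.mem_append.1 h2 with h2 | h2
      · exact h2
      · have := hUW x h1 y h2
        omega
    · have := pw hVW h1
      omega
  have hbc := descent (x := b) (y := c) ((List.sublist_cons_self _ _).trans hl) (by omega)
  have hab : [a, b].Sublist (U ++ (V ++ W)) :=
    List.Sublist.trans (by simp) hl
  have hbU : b ∉ V ++ W := by
    intro h
    rcases List.mem_append.1 h with h | h
    · exact lt_irrefl _ (hVV b h b (Or.inl hbc.1))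
    · exact lt_irrefl _ (hUW b hbc.1 b h)
  rcases h' with h' | h'
  · have := descent hab h'.2
    exact hbU (List.mem_append_left _ this.2)
  · have haU : a ∈ U := by
      rcases pair_sublist_append.1 hab with h1 | ⟨h1, -⟩ | h1
      · exact h1.subset (by simp)
      · exact h1
      · exact absurd (h1.subset (by simp)) hbU
    have := hVV c hbc.2 a (Or.inl haU)
    omega

theorem ShapeB.length_eq {s q : ℕ} {σ : List ℕ} (h : ShapeB s q σ) : σ.length = q + s := by
  obtain ⟨U, V, W, rfl, -, -, rfl, rfl⟩ := h
  simp

/-- The shape after inserting a minimum behind `i` entries. -/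
def childB (s q i : ℕ) : ℕ × ℕ :=
  if i = 0 then (0, q + 1) else if i < q then (q - i + 1, i) else
    if i = q then (s + 1, q) else (i - q, q)

/-- The sites `0 < i < q` give the tree children `(q - i + 1, i)`, and `i = 0` gives `(0, q + 1)`.
The remaining sites give `(1, q), …, (s + 1, q)`, which are the last missing child of the first sum
and all of the second. For `q = 0` this count needs `s = 0`, which is why a list of that shape is
required. -/
theorem sum_childB (s q : ℕ) (f : ℕ → ℕ → ℕ) (h : ∃ σ, ShapeB s q σ) :
    ∑ i ∈ Finset.range (q + s + 1), f (childB s q i).1 (childB s q i).2 =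
      ∑ i ∈ Finset.range (q + 1), f (q - i) (i + 1) + ∑ j ∈ Finset.range s, f (j + 2) q := by
  obtain ⟨-, U, V, W, -, -, hUV, rfl, rfl⟩ := h
  generalize hs : V.length + W.length = s
  cases U with
  | nil =>
    obtain rfl : s = 0 := by
      rcases hUV with ⟨rfl, rfl⟩ | ⟨h, -⟩
      · exact hs.symm
      · exact absurd rfl h
    simp [childB]
  | cons u U =>
    simp only [List.length_cons]
    generalize U.length = p
    rw [show p + 1 + s + 1 = 1 + (p + (1 + s)) by omega, Finset.sum_range_add,
      Finset.sum_range_add, Finset.sum_range_add, Finset.sum_range_one, Finset.sum_range_one]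
    have h1 : ∑ x ∈ Finset.range p, f (childB s (p + 1) (1 + x)).1 (childB s (p + 1) (1 + x)).2 =
        ∑ i ∈ Finset.range p, f (p + 1 - i) (i + 1) := by
      refine Finset.sum_congr rfl fun i hi => ?_
      have := Finset.mem_range.1 hi
      rw [childB, if_neg (by omega), if_pos (by omega)]
      congr 1 <;> simp only <;> omega
    have h2 : ∑ x ∈ Finset.range s, f (childB s (p + 1) (1 + (p + (1 + x)))).1
        (childB s (p + 1) (1 + (p + (1 + x)))).2 = ∑ x ∈ Finset.range s, f (x + 1) (p + 1) := by
      refine Finset.sum_congr rfl fun i hi => ?_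
      rw [childB, if_neg (by omega), if_neg (by omega), if_neg (by omega)]
      congr 1; simp only; omega
    have h3 : f (s + 1) (p + 1) + ∑ x ∈ Finset.range s, f (x + 1) (p + 1) =
        f 1 (p + 1) + ∑ j ∈ Finset.range s, f (j + 2) (p + 1) := by
      rw [add_comm, ← Finset.sum_range_succ (fun x => f (x + 1) (p + 1)),
        Finset.sum_range_succ', add_comm]
    have h4 : childB s (p + 1) (1 + (p + 0)) = (s + 1, p + 1) := by
      rw [childB, if_neg (by omega), if_neg (by omega), if_pos (by omega)]
    rw [h1, h2, h4, h3, Finset.sum_range_succ, Finset.sum_range_succ]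
    simp only [childB, if_pos, Nat.sub_self, Nat.add_sub_cancel_left]
    ring

theorem isMaxPrefix_of_shapeB {s q : ℕ} {σ ρ : List ℕ} (h : ShapeB s q σ)
    (hρ : ∀ t ρ', ρ = t :: ρ' → ∃ l : List ℕ, l.Sublist (σ ++ [t]) ∧ OccB l) :
    IsMaxPrefix OccB σ (σ ++ ρ) :=
  ⟨ρ, rfl, h.free, fun t ρ' ht hf => by
    obtain ⟨l, h1, h2⟩ := hρ t ρ' ht
    exact hf l h1 h2⟩

/-- A minimum placed before some `u` of `U` ends the free prefix with `U`, since the next entry `v`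
of `V` gives the 132 `1, u, v`. Placed between `U` and `V` it joins `V`, and the whole list stays
free. Placed further right it is itself excluded by the 321 `u, v, 1`. -/
theorem shapeB_insertMin {s q : ℕ} {σ : List ℕ} (h : ShapeB s q σ) (hpos : ∀ a ∈ σ, 0 < a)
    {i : ℕ} (hi : i ≤ q + s) : ∃ σ', ShapeB (childB s q i).1 (childB s q i).2 σ' ∧
      IsMaxPrefix OccB σ' (insertMin i σ) := by
  have hlen := h.length_eq
  obtain ⟨U, V, W, rfl, hp, hUV, rfl, rfl⟩ := h
  have hp' : ∀ L : List ℕ, L.Sublist (V ++ U ++ W) →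
      (1 :: L.map Nat.succ).Pairwise (· < ·) := by
    intro L hL
    rw [List.pairwise_cons, List.pairwise_map]
    refine ⟨?_, (hp.sublist hL).imp (by intro a b h; omega)⟩
    intro a ha
    obtain ⟨c, hc, rfl⟩ := List.mem_map.1 ha
    have := hpos c (by
      have := hL.subset hc
      simp only [List.mem_append] at this ⊢
      tauto)
    omega
  have hVU : ∀ v ∈ V, ∀ u ∈ U, 0 < v ∧ v < u := fun v hv u hu =>
    ⟨hpos v (by simp [hv]), (List.pairwise_append.1 (List.pairwise_append.1 hp).1).2.2 v hv u hu⟩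
  obtain ⟨A, B, hAB, rfl, hins⟩ := exists_insertMin_eq (hlen ▸ hi)
  rw [hins]
  have h132 : ∀ v ∈ V, ∀ u ∈ U, ∀ A U₂ : List ℕ, u ∈ U₂ →
      ∃ l : List ℕ, l.Sublist (A.map Nat.succ ++ (1 :: U₂.map Nat.succ) ++ [v + 1]) ∧
        OccB l := by
    intro v hv u hu A U₂ hu₂
    have := hVU v hv u hu
    refine ⟨[1, u + 1, v + 1], ?_, _, _, _, rfl, by omega⟩
    refine List.Sublist.append (l₁ := [1, u + 1]) ?_ (List.Sublist.refl [v + 1])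
    refine List.Sublist.trans (List.Sublist.cons_cons 1 ?_) (List.sublist_append_right _ _)
    exact List.singleton_sublist.2 (List.mem_map.2 ⟨u, hu₂, rfl⟩)
  -- The site at the right end of `U` is assigned to the second case, with `P` empty.
  have hsplit : (∃ U₂, U₂ ≠ [] ∧ U = A ++ U₂ ∧ B = U₂ ++ (V ++ W)) ∨
      ∃ P, A = U ++ P ∧ V ++ W = P ++ B := by
    rcases List.append_eq_append_iff.1 hAB.symm with ⟨U₂, rfl, rfl⟩ | h
    · rcases eq_or_ne U₂ [] with rfl | hne
      · exact Or.inr ⟨[], by simp⟩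
      · exact Or.inl ⟨U₂, hne, rfl, rfl⟩
    · exact Or.inr h
  have hVW : V ++ W ≠ [] → U ≠ [] ∧ V ≠ [] := by
    intro h
    rcases hUV with ⟨rfl, rfl⟩ | h'
    · exact absurd rfl h
    · exact h'
  have hfirst : ∀ {t ρ'}, (V ++ W).map Nat.succ = t :: ρ' → ∃ v ∈ V, t = v + 1 := by
    intro t ρ' ht
    have hne : V ++ W ≠ [] := by
      rintro h
      simp [h] at ht
    obtain ⟨v, V', rfl⟩ := List.exists_cons_of_ne_nil (hVW hne).2
    simp only [List.cons_append, List.map_cons, List.cons.injEq] at ht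
    exact ⟨v, by simp, ht.1.symm⟩
  rcases hsplit with ⟨U₂, hU₂, rfl, rfl⟩ | ⟨P, rfl, hP⟩
  · obtain ⟨u, hu⟩ := List.exists_mem_of_ne_nil U₂ hU₂
    have hlen₂ := List.length_pos_iff.2 hU₂
    have h1 : ShapeB (childB (V.length + W.length) (A ++ U₂).length A.length).1
        (childB (V.length + W.length) (A ++ U₂).length A.length).2
        (A.map Nat.succ ++ (1 :: U₂.map Nat.succ)) := by
      have hpw := hp' (A ++ U₂)
        ((List.sublist_append_right _ _).trans (List.sublist_append_left _ _))
      rcases eq_or_ne A [] with rfl | hA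
      · rw [childB, if_pos List.length_nil]
        exact ⟨1 :: U₂.map Nat.succ, [], [], by simp, by simpa using hpw, by simp, by simp,
          by simp⟩
      · have hlenA := List.length_pos_iff.2 hA
        rw [childB, if_neg (by omega), if_pos (by simp; omega)]
        exact ⟨A.map Nat.succ, [1], U₂.map Nat.succ, by simp, by simpa using hpw,
          Or.inr (by simpa using hA), by simp, by simp; omega⟩
    refine ⟨_, h1, ?_⟩
    have := isMaxPrefix_of_shapeB (ρ := (V ++ W).map Nat.succ) h1 ?_
    · simpa using this
    · intro t ρ' ht
      obtain ⟨v, hv, rfl⟩ := hfirst ht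
      exact h132 v hv u (by simp [hu]) A U₂ hu
  · rcases eq_or_ne P [] with rfl | hPne
    · rw [List.nil_append] at hP
      subst hP
      rcases eq_or_ne U [] with rfl | hU
      · obtain ⟨rfl, rfl⟩ : V = [] ∧ W = [] := by
          rcases hUV with h | ⟨h, -⟩
          · exact h
          · exact absurd rfl h
        have h1 : ShapeB 0 1 [1] := ⟨[1], [], [], by simp⟩
        refine ⟨[1], h1, ?_⟩
        exact isMaxPrefix_of_shapeB (ρ := []) h1 (by simp)
      · have hlenU := List.length_pos_iff.2 hU
        have h1 : ShapeB (childB (V.length + W.length) U.length (U ++ []).length).1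
            (childB (V.length + W.length) U.length (U ++ []).length).2
            (U.map Nat.succ ++ 1 :: (V ++ W).map Nat.succ) := by
          rw [childB, if_neg (by simpa using hU), if_neg (by simp), if_pos (by simp)]
          refine ⟨U.map Nat.succ, 1 :: V.map Nat.succ, W.map Nat.succ, by simp, ?_,
            Or.inr (by simpa using hU), by simp, by simp; omega⟩
          simpa using hp' _ (List.Sublist.refl _)
        refine ⟨_, h1, ?_⟩
        simpa using isMaxPrefix_of_shapeB (ρ := []) h1 (by simp)
    · have hne := hVW (by rw [hP]; simp [hPne])
      have hlenP := List.length_pos_iff.2 hPne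
      have hlenU := List.length_pos_iff.2 hne.1
      have hchild : childB (V.length + W.length) U.length (U ++ P).length =
          (P.length, U.length) := by
        rw [childB, if_neg (by simp [hPne]), if_neg (by simp), if_neg (by simp; omega)]
        simp
      rw [hchild]
      have h1 : ShapeB P.length U.length ((U ++ P).map Nat.succ) := by
        rcases List.append_eq_append_iff.1 hP.symm with ⟨V₂, rfl, rfl⟩ | ⟨W₁, rfl, rfl⟩
        · refine ⟨U.map Nat.succ, P.map Nat.succ, [], by simp, ?_,
            Or.inr (by simpa using ⟨hne.1, hPne⟩), by simp, by simp⟩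
          have := (hp' (P ++ U) ?_).of_cons
          · simpa using this
          · refine List.Sublist.trans ?_ (List.sublist_append_left _ _)
            exact List.Sublist.append_right (List.sublist_append_left _ _) _
        · refine ⟨U.map Nat.succ, V.map Nat.succ, W₁.map Nat.succ, by simp, ?_,
            Or.inr (by simpa using hne), by simp, by simp⟩
          have := (hp' (V ++ U ++ W₁) ?_).of_cons
          · simpa using this
          · exact List.Sublist.append_left (List.sublist_append_left _ _) _
      refine ⟨_, h1, isMaxPrefix_of_shapeB h1 ?_⟩
      intro t ρ' ht
      rw [List.cons.injEq] at ht
      obtain ⟨rfl, -⟩ := ht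
      obtain ⟨u, hu⟩ := List.exists_mem_of_ne_nil U hne.1
      obtain ⟨v, hv, hvP⟩ : ∃ v ∈ V, v ∈ P := by
        obtain ⟨v, V', rfl⟩ := List.exists_cons_of_ne_nil hne.2
        obtain ⟨p, P', rfl⟩ := List.exists_cons_of_ne_nil hPne
        simp only [List.cons_append, List.cons.injEq] at hP
        exact ⟨v, by simp, by simp [hP.1]⟩
      have := hVU v hv u hu
      refine ⟨[u + 1, v + 1, 1], ?_, _, _, _, rfl, by omega⟩
      refine List.Sublist.append (l₁ := [u + 1, v + 1]) ?_ (List.Sublist.refl [1])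
      rw [List.map_append]
      exact pair_sublist_append.2 (Or.inr (Or.inl
        ⟨List.mem_map.2 ⟨u, hu, rfl⟩, List.mem_map.2 ⟨v, hvP, rfl⟩⟩))

theorem card_permClass_occB (n : ℕ) : (permClass OccB n).card = treeCount n 0 0 :=
  card_permClass occB_map_succ (by simp [OccB]) ShapeB childB
    (fun s q f h => sum_childB s q f h)
    ⟨[], [], [], by simp⟩ (fun _ _ _ h => h.length_eq)
    (fun _ _ _ h hpos _ hi => shapeB_insertMin h hpos hi) n

/-! ### Counting the two classes -/

theorem freeAbove_occA_iff {σ : List ℕ} : FreeAbove OccA σ ↔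
    ¬ Contains σ [2, 3, 4, 1] ∧ ¬ Contains σ [3, 2, 4, 1] ∧ ¬ Contains σ [4, 5, 2, 3, 1] := by
  rw [contains_2341_iff, contains_3241_iff, contains_45231_iff]
  constructor
  · intro h
    refine ⟨?_, ?_, ?_⟩
    · rintro ⟨a, b, c, d, hs, h1, h2, h3⟩
      exact h [a, b, c] d hs (by simp; omega) (Or.inl ⟨a, b, c, rfl, by omega⟩)
    · rintro ⟨a, b, c, d, hs, h1, h2, h3⟩
      exact h [a, b, c] d hs (by simp; omega) (Or.inl ⟨a, b, c, rfl, by omega⟩)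
    · rintro ⟨a, b, c, d, e, hs, h1, h2, h3, h4⟩
      exact h [a, b, c, d] e hs (by simp; omega) (Or.inr ⟨a, b, c, d, rfl, by omega⟩)
  · rintro ⟨h1, h2, h3⟩ l d hs hd (⟨a, b, c, rfl, h | h⟩ | ⟨a, b, c, e, rfl, h⟩)
    · simp only [List.mem_cons, List.not_mem_nil, or_false, forall_eq_or_imp, forall_eq] at hd
      exact h1 ⟨a, b, c, d, hs, by omega⟩
    · simp only [List.mem_cons, List.not_mem_nil, or_false, forall_eq_or_imp, forall_eq] at hd
      exact h2 ⟨a, b, c, d, hs, by omega⟩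
    · simp only [List.mem_cons, List.not_mem_nil, or_false, forall_eq_or_imp, forall_eq] at hd
      exact h3 ⟨a, b, c, e, d, hs, by omega⟩

theorem ncard_Av_2341_3241_45231 (n : ℕ) :
    (Av {[2, 3, 4, 1], [3, 2, 4, 1], [4, 5, 2, 3, 1]} ∩ S n).ncard = treeCount n 0 0 := by
  rw [← card_permClass_occA, ← Set.ncard_coe_finset]
  congr 1
  ext σ
  rw [mem_Av_inter_S_iff, Finset.mem_coe, mem_permClass_iff occA_map_succ, freeAbove_occA_iff]
  simp

/-- The reverse complement of a rearrangement of `1, …, n`. -/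
def reverseComplement (n : ℕ) (σ : List ℕ) : List ℕ := (σ.map (n + 1 - ·)).reverse

theorem reverseComplement_reverseComplement {n : ℕ} {σ : List ℕ} (h : σ ∈ S n) :
    reverseComplement n (reverseComplement n σ) = σ := by
  rw [reverseComplement, reverseComplement, ← List.map_reverse, List.reverse_reverse, List.map_map]
  conv_rhs => rw [← List.map_id σ]
  refine List.map_congr_left fun a ha => ?_
  have := (mem_iff_of_mem_S h).1 ha
  simp only [Function.comp_apply, id_eq]
  omega

theorem reverseComplement_mem_S {n : ℕ} {σ : List ℕ} (h : σ ∈ S n) :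
    reverseComplement n σ ∈ S n := by
  have hnd : (reverseComplement n σ).Nodup := by
    rw [reverseComplement, List.nodup_reverse]
    refine List.Nodup.map_on (fun a ha b hb hab => ?_) (nodup_of_mem_S h)
    have := (mem_iff_of_mem_S h).1 ha
    have := (mem_iff_of_mem_S h).1 hb
    omega
  refine (List.subperm_of_subset hnd fun a ha => ?_).perm_of_length_le ?_
  · rw [reverseComplement, List.mem_reverse, List.mem_map] at ha
    obtain ⟨b, hb, rfl⟩ := ha
    have := (mem_iff_of_mem_S h).1 hb
    rw [List.mem_range'_1]
    omega
  · simp [reverseComplement, length_of_mem_S h]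

theorem sublist_reverseComplement {n : ℕ} {l σ : List ℕ} (h : l.Sublist σ) :
    (reverseComplement n l).Sublist (reverseComplement n σ) :=
  (h.map _).reverse

/-- Reverse complement fixes 4321 and turns 4213 into 2431; these are 321 and 132 followed by a
smaller entry. -/
theorem freeAbove_occB_reverseComplement_iff {n : ℕ} {σ : List ℕ} (hσ : σ ∈ S n) :
    FreeAbove OccB (reverseComplement n σ) ↔
      ¬ Contains σ [4, 3, 2, 1] ∧ ¬ Contains σ [4, 2, 1, 3] := by
  rw [contains_4321_iff, contains_4213_iff]
  have hle : ∀ {ρ l : List ℕ}, ρ ∈ S n → l.Sublist ρ → ∀ a ∈ l, a ≤ n := fun hρ hs a ha =>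
    ((mem_iff_of_mem_S hρ).1 (hs.subset ha)).2
  constructor
  · intro h
    refine ⟨?_, ?_⟩ <;>
    · rintro ⟨a, b, c, d, hs, hlt⟩
      have hn := hle hσ hs
      simp only [List.mem_cons, List.not_mem_nil, or_false, forall_eq_or_imp, forall_eq] at hn
      exact h [n + 1 - d, n + 1 - c, n + 1 - b] (n + 1 - a) (sublist_reverseComplement hs)
        (by simp; omega) ⟨_, _, _, rfl, by omega⟩
  · rintro ⟨h1, h2⟩ l d hs hd ⟨a, b, c, rfl, h⟩
    have hn := hle (reverseComplement_mem_S hσ) hs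
    have hs' := sublist_reverseComplement (n := n) hs
    rw [reverseComplement_reverseComplement hσ] at hs'
    simp only [List.mem_cons, List.not_mem_nil, or_false, forall_eq_or_imp, forall_eq,
      List.cons_append, List.nil_append] at hn hd
    rcases h with h | h
    · exact h1 ⟨n + 1 - d, n + 1 - c, n + 1 - b, n + 1 - a, hs', by omega⟩
    · exact h2 ⟨n + 1 - d, n + 1 - c, n + 1 - b, n + 1 - a, hs', by omega⟩

theorem ncard_Av_4321_4213 (n : ℕ) :
    (Av {[4, 3, 2, 1], [4, 2, 1, 3]} ∩ S n).ncard = treeCount n 0 0 := by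
  rw [← card_permClass_occB, ← Set.ncard_coe_finset]
  have hinj : Set.InjOn (reverseComplement n)
      (Av {[4, 3, 2, 1], [4, 2, 1, 3]} ∩ S n) := by
    intro σ hσ τ hτ h
    rw [← reverseComplement_reverseComplement hσ.2, h, reverseComplement_reverseComplement hτ.2]
  rw [← hinj.ncard_image]
  congr 1
  ext σ
  rw [Set.mem_image, Finset.mem_coe, mem_permClass_iff occB_map_succ]
  simp only [mem_Av_inter_S_iff, Set.mem_insert_iff, Set.mem_singleton_iff, forall_eq_or_imp,
    forall_eq]
  constructor
  · rintro ⟨τ, ⟨h1, h2⟩, rfl⟩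
    exact ⟨reverseComplement_mem_S h1, (freeAbove_occB_reverseComplement_iff h1).2 h2⟩
  · rintro ⟨h1, h2⟩
    have h3 := reverseComplement_mem_S h1
    refine ⟨_, ⟨h3, (freeAbove_occB_reverseComplement_iff h3).1 ?_⟩,
      reverseComplement_reverseComplement h1⟩
    rwa [reverseComplement_reverseComplement h1]

/-! ### Bases and the imbalance -/

theorem finite_S (n : ℕ) : (S n).Finite := by
  refine ((List.range' 1 n).permutations.toFinset.finite_toSet).subset fun σ hσ => ?_
  rw [Finset.mem_coe, List.mem_toFinset, List.mem_permutations]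
  exact hσ

theorem mem_basis_45231 :
    [4, 5, 2, 3, 1] ∈ basis (Av {[2, 3, 4, 1], [3, 2, 4, 1], [4, 5, 2, 3, 1]}) := by
  refine ⟨⟨by decide, by decide⟩, by decide, fun h => ?_, ?_⟩
  · exact h.2.2 [4, 5, 2, 3, 1] (by simp) ⟨_, List.Sublist.refl _, by decide⟩
  · rintro ρ ⟨u, hu, rfl⟩ hne
    -- Minimality is a finite check over all sublists of 45231 and all sublists of their
    -- normalizations.
    have key : ∀ u ∈ [4, 5, 2, 3, 1].sublists', u = [4, 5, 2, 3, 1] ∨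
        ((normalize u).Nodup ∧ (∀ a ∈ normalize u, 0 < a) ∧
          normalize (normalize u) = normalize u ∧ ∀ v ∈ (normalize u).sublists',
            normalize v ≠ [2, 3, 4, 1] ∧ normalize v ≠ [3, 2, 4, 1] ∧
              normalize v ≠ [4, 5, 2, 3, 1]) := by
      decide +kernel
    rcases key u (List.mem_sublists'.2 hu) with rfl | ⟨h1, h2, h3, h4⟩
    · exact absurd (by decide) hne
    · refine ⟨⟨h1, h2⟩, h3, ?_⟩
      rintro τ hτ ⟨v, hv, rfl⟩
      have := h4 v (List.mem_sublists'.2 hv)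
      simp only [Set.mem_insert_iff, Set.mem_singleton_iff] at hτ
      tauto

/-- A basis element contains some pattern of `T`. Were that pattern different from it, minimality
would place the pattern in `Av T`, although it contains itself. -/
theorem mem_of_mem_basis_Av {T : Set (List ℕ)} {τ : List ℕ} (h : τ ∈ basis (Av T)) :
    τ ∈ T := by
  obtain ⟨h1, h2, h3, h4⟩ := h
  have : ∃ ρ ∈ T, Contains τ ρ := by
    by_contra! hno
    exact h3 ⟨h1, h2, hno⟩
  obtain ⟨ρ, hρ, hτρ⟩ := this
  by_contra hτ
  have hne : ρ ≠ τ := by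
    rintro rfl
    exact hτ hρ
  have hmem := h4 ρ hτρ hne
  exact hmem.2.2 ρ hρ ⟨ρ, List.Sublist.refl _, hmem.2.1⟩

theorem unbalancedWilfEquivalent_Av :
    UnbalancedWilfEquivalent (Av {[2, 3, 4, 1], [3, 2, 4, 1], [4, 5, 2, 3, 1]})
      (Av {[4, 3, 2, 1], [4, 2, 1, 3]}) := by
  refine ⟨fun n => by rw [ncard_Av_2341_3241_45231, ncard_Av_4321_4213], 5, ?_⟩
  have h : basis (Av {[4, 3, 2, 1], [4, 2, 1, 3]}) ∩ S 5 = ∅ := by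
    refine Set.eq_empty_of_forall_notMem fun τ hτ => ?_
    have h1 := mem_of_mem_basis_Av hτ.1
    have h2 := length_of_mem_S hτ.2
    rcases h1 with rfl | rfl <;> simp at h2
  rw [h, Set.ncard_empty]
  refine Set.ncard_ne_zero_of_mem (a := [4, 5, 2, 3, 1]) ⟨mem_basis_45231, ?_⟩
    ((finite_S 5).subset Set.inter_subset_right)
  change List.Perm _ _
  decide

end StackSorting

theorem theorem3p1 :
    -- the generating function of the numbers `|s⁻¹(Av_n(231, 321))|`
    PowerSeries.mk (fun n : ℕ =>
        ((StackSorting.stackPreimage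
          (StackSorting.Av {[2, 3, 1], [3, 2, 1]} ∩ StackSorting.S n)).ncard : ℚ)) =
      (1 - PowerSeries.X *
        PowerSeries.subst (PowerSeries.X * StackSorting.catalanGF) StackSorting.catalanGF)⁻¹ ∧
    -- the preimage is a permutation class
    StackSorting.stackPreimage (StackSorting.Av {[2, 3, 1], [3, 2, 1]}) =
      StackSorting.Av {[2, 3, 4, 1], [3, 2, 4, 1], [4, 5, 2, 3, 1]} ∧
    -- the unbalanced Wilf equivalence
    StackSorting.UnbalancedWilfEquivalent
      (StackSorting.Av {[2, 3, 4, 1], [3, 2, 4, 1], [4, 5, 2, 3, 1]})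
      (StackSorting.Av {[4, 3, 2, 1], [4, 2, 1, 3]}) := by
  refine ⟨?_, StackSorting.stackPreimage_Av, StackSorting.unbalancedWilfEquivalent_Av⟩
  ext n
  rw [PowerSeries.coeff_mk, StackSorting.stackPreimage_Av_inter_S,
    StackSorting.ncard_Av_2341_3241_45231]
  exact (StackSorting.coeff_eq_treeCount_root n).symm
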